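/- Fix an integer $r\ge 2$ and a constant $M$. For a parameter $\bm B=(\bm\beta_2,\dots,\bm\beta_r)$, $\bm\beta_s=(\beta_{s,v})_{v\in[n]}\in\mathbb R^n$, the $r$-layered hypergraph $\beta$-model $\mathsf H_{[r]}(n,\bm B)$ is the random hypergraph on the vertex set $[n]$ in which, for every $2\le s\le r$, each $s$-element set $e\subseteq[n]$ is a hyperedge, independently of all others, with probability $$p_e=\frac{\exp\big(\sum_{v\in e}\beta_{s,v}\big)}{1+\exp\big(\sum_{v\in e}\beta_{s,v}\big)} .$$ The $s$-degree $d_s(v)$ is the number of hyperedges of size $s$ containing $v$, and $\sigma_s(v)\ge 0$ is defined by $\sigma_s(v)^2=\operatorname{Var}[d_s(v)]$ under the model. A maximum likelihood (ML) estimator $\hat{\bm B}=(\hat{\bm\beta}_2,\dots,\hat{\bm\beta}_r)$ is a function of the observed hypergraph $H$ which is a maximizer over all parameters $\bm B'$ of the likelihood $\mathbb P_{\bm B'}(\{H\})$ whenever a maximizer exists, and has an arbitrary value otherwise. Let $n$ run through any sequence of integers tending to infinity. For each such $n$ let $\bm B=\bm B^{(n)}$ be a parameter with $|\beta_{s,v}|\le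 M$ for all $2\le s\le r$ and $v\in[n]$, let $H_n\sim\mathsf H_{[r]}(n,\bm B)$, and let $\hat{\bm B}$ be any ML estimator evaluated at $H_n$. Fix integers $a_s\ge 0$, $2\le s\le r$, and for each $n$ and $s$ let $J_s=\{v_{s,1},\dots,v_{s,a_s}\}\subseteq[n]$ be a set of $a_s$ distinct vertices (for instance a fixed set; in general $J_s$ may depend on $n$). Then, as $n\to\infty$, $$\Big(\sigma_s(v_{s,i})\,\big(\hat\beta_{s,v_{s,i}}-\beta_{s,v_{s,i}}\big)\Big)_{2\le s\le r,\ 1\le i\le a_s}\ \xrightarrow{\ D\ }\ \mathcal N_{\sum_{s=2}^r a_s}(\bm 0,\bm I),$$ jointly over all layers. -/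

import Mathlib

open MeasureTheory ProbabilityTheory Filter

namespace HypergraphBeta

/-- The layers `2 ≤ s ≤ r` (possible sizes of a hyperedge). -/
abbrev Layer (r : ℕ) : Type := {s : ℕ // s ∈ Finset.Icc 2 r}

/-- The potential hyperedges on `n` vertices: a layer `s` and a set of exactly `s` vertices. -/
abbrev HyperEdge (n r : ℕ) : Type := Σ s : Layer r, {e : Finset (Fin n) // e.card = s.1}

/-- Hypergraphs on the vertex set `Fin n` with all hyperedge sizes between `2` and `r`, given by
the indicator of the edge set: `e` is a hyperedge of `H` iff `H e = true`. -/
abbrev LayeredHypergraph (n r : ℕ) : Type := HyperEdge n r → Bool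

/-- Parameters `B = (β_2, …, β_r)` with `β_s ∈ ℝ^n`. -/
abbrev Params (n r : ℕ) : Type := Layer r → Fin n → ℝ

/-- `exp (∑_{v ∈ e} β_{s,v}) / (1 + exp (∑_{v ∈ e} β_{s,v}))` for an edge `e` of layer `s`. -/
noncomputable def edgeProb {n r : ℕ} (B : Params n r) (e : HyperEdge n r) : ℝ :=
  Real.exp (∑ v ∈ e.2.1, B e.1 v) / (1 + Real.exp (∑ v ∈ e.2.1, B e.1 v))

theorem edgeProb_mem {n r : ℕ} (B : Params n r) (e : HyperEdge n r) :
    edgeProb B e ∈ Set.Icc (0 : ℝ) 1 := by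
  have h := Real.exp_pos (∑ v ∈ e.2.1, B e.1 v)
  refine ⟨?_, ?_⟩
  · unfold edgeProb; positivity
  · unfold edgeProb
    rw [div_le_one (by positivity)]
    linarith

/-- The `r`-layered hypergraph β-model: every potential hyperedge `e` is present, independently of
the others, with probability `edgeProb B e`. -/
noncomputable def layeredBeta {n r : ℕ} (B : Params n r) : Measure (LayeredHypergraph n r) :=
  Measure.pi fun e : HyperEdge n r => bernoulliMeasure true false ⟨edgeProb B e, edgeProb_mem B e⟩

instance {n r : ℕ} (B : Params n r) : IsProbabilityMeasure (layeredBeta B) := by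
  unfold layeredBeta; infer_instance

/-- The `s`-degree of `v`: the number of hyperedges of size `s` of `H` that contain `v`. -/
def sDegree {n r : ℕ} (s : Layer r) (v : Fin n) (H : LayeredHypergraph n r) : ℕ :=
  (Finset.univ.filter fun e : {e : Finset (Fin n) // e.card = s.1} =>
    v ∈ e.1 ∧ H ⟨s, e⟩ = true).card

/-- `σ_s(v)`, the square root of the variance of the `s`-degree of `v` in the model. -/
noncomputable def sigma {n r : ℕ} (B : Params n r) (s : Layer r) (v : Fin n) : ℝ :=
  Real.sqrt (Var[fun H : LayeredHypergraph n r => (sDegree s v H : ℝ); layeredBeta B])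

/-- The likelihood of the parameter `B` given the observed hypergraph `H`. -/
noncomputable def likelihood {n r : ℕ} (H : LayeredHypergraph n r) (B : Params n r) : ℝ :=
  (layeredBeta B).real {H}

/-- `Bhat` is a maximum likelihood estimator: it returns a maximizer of the likelihood over the
whole parameter space at every `H` for which there is one. At the other `H` its value is
arbitrary. -/
def IsMLE {n r : ℕ} (Bhat : LayeredHypergraph n r → Params n r) : Prop :=
  ∀ H : LayeredHypergraph n r,
    (∃ B : Params n r, IsMaxOn (likelihood H) Set.univ B) →
      IsMaxOn (likelihood H) Set.univ (Bhat H)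

end HypergraphBeta

namespace HypergraphBeta

/-! The likelihood factors over the layers, and in each layer it is a logistic exponential family
whose sufficient statistics are the `s`-degrees. The score at the true parameter is thus the vector
D of centred degrees. Its covariance, which is also the Fisher information, is the Gram matrix G =
∑ₑ wₑ 1ₑ1ₑᵀ with wₑ = pₑ(1 - pₑ), and σ_s(v)² = G_vv. Write q = `thru n s` and m = `thruPair n s`.
For bounded parameters the diagonal of G has order q and its off-diagonal entries are at most m =
O(q/n), so G is well conditioned and G⁻¹ is nearly diagonal.

Existence and localization: with high probability ∑ D_u² ≤ Knq (Markov) and max |D_u| is at most a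
small multiple of q (Hoeffding and a union bound). A maximizer of the likelihood over the unit box
around the truth satisfies an ℓ² error bound, and near-diagonality turns it into coordinatewise
control that excludes the boundary of the box. By concavity the point is a global maximizer
(`exists_isMax_near`), by `eq_of_score_eq_zero` the only one, so it is the ML estimate.

Linearization: for the error Δ, the likelihood equations read D = GΔ + R with R quadratic in Δ.
Writing column v of G⁻¹ as e_v/G_vv + z gives σΔ_v = D_v/σ + σ⟨z, D⟩ - σ(R_v/σ² + ⟨z, R⟩). The last
term is O(K/√q) on the good event (`abs_linearization_le`), and the middle one has variance O(1/n)
(`measureReal_correction_ge_le`). Only the single coordinate D_v has to be of size √q, so no maximal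
inequality at that scale is needed.

Central limit theorem: a linear combination of normalized degrees is a sum of independent, uniformly
small edge terms, so its characteristic function is close to Gaussian
(`norm_charFun_linStat_sub_le`). The covariance of the normalized degrees tends to the identity,
since distinct vertices share few edges and layers are independent (`abs_statVar_sub_le`). Lévy's
continuity theorem concludes. -/

/-- The `s`-element subsets of `Fin n`. -/
abbrev SEdge (n s : ℕ) : Type := {e : Finset (Fin n) // e.card = s}

/-- The sum of the vertex weights over an edge. -/
def edgeSum {n s : ℕ} (x : Fin n → ℝ) (e : SEdge n s) : ℝ := ∑ u ∈ e.1, x u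

/-- The sum of the edge weights over the edges through a vertex. -/
def vertexSum {n s : ℕ} (g : SEdge n s → ℝ) (u : Fin n) : ℝ :=
  ∑ e : SEdge n s with u ∈ e.1, g e

/-- The number of `s`-edges through a vertex. -/
noncomputable def thru (n s : ℕ) : ℝ := ((n - 1).choose (s - 1) : ℕ)

/-- The number of `s`-edges through two distinct vertices. -/
noncomputable def thruPair (n s : ℕ) : ℝ := ((n - 2).choose (s - 2) : ℕ)

/-- The weighted Gram map `x ↦ ∑ₑ wₑ ⟨1ₑ, x⟩ 1ₑ`. -/
def gram {n s : ℕ} (w : SEdge n s → ℝ) (x : Fin n → ℝ) (u : Fin n) : ℝ :=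
  vertexSum (fun e => w e * edgeSum x e) u

/-! ### Counting edges through one and through two vertices. -/

section Counting

variable {n s : ℕ}

theorem card_edges_superset (T : Finset (Fin n)) (hT : T.card ≤ s) :
    (Finset.univ.filter fun e : SEdge n s => T ⊆ e.1).card
      = (n - T.card).choose (s - T.card) := by
  have h := Finset.card_filter_powersetCard_subset T Finset.univ s (Finset.subset_univ _) hT
  rw [Finset.card_univ, Fintype.card_fin] at h
  rw [← h]
  refine Finset.card_bij (fun e _ => e.1) ?_ ?_ ?_
  · intro e he
    simp only [Finset.mem_filter, Finset.mem_univ, true_and] at he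
    simp [e.2, he]
  · intro e _ e' _ hee
    exact Subtype.ext hee
  · intro b hb
    simp only [Finset.mem_filter, Finset.mem_powersetCard, Finset.subset_univ, true_and] at hb
    exact ⟨⟨b, hb.1⟩, by simp [hb.2], rfl⟩

theorem card_edges_mem (hs : 1 ≤ s) (u : Fin n) :
    ((Finset.univ.filter fun e : SEdge n s => u ∈ e.1).card : ℝ) = thru n s := by
  have h := card_edges_superset (s := s) {u} (by simpa using hs)
  simp only [Finset.singleton_subset_iff, Finset.card_singleton] at h
  rw [h, thru]

theorem card_edges_mem_mem (hs : 2 ≤ s) {u v : Fin n} (huv : u ≠ v) :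
    ((Finset.univ.filter fun e : SEdge n s => u ∈ e.1 ∧ v ∈ e.1).card : ℝ) = thruPair n s := by
  have h := card_edges_superset (s := s) {u, v} (by simpa [Finset.card_pair huv] using hs)
  simp only [Finset.insert_subset_iff, Finset.singleton_subset_iff, Finset.card_pair huv] at h
  rw [h, thruPair]

theorem thru_nonneg : 0 ≤ thru n s := Nat.cast_nonneg _

theorem thruPair_nonneg : 0 ≤ thruPair n s := Nat.cast_nonneg _

theorem thruPair_mul (hs : 2 ≤ s) (hn : 2 ≤ n) :
    ((n : ℝ) - 1) * thruPair n s = (s - 1) * thru n s := by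
  obtain ⟨s, rfl⟩ := Nat.exists_eq_add_of_le' hs
  obtain ⟨n, rfl⟩ := Nat.exists_eq_add_of_le' hn
  have h := Nat.add_one_mul_choose_eq n s
  simp only [thru, thruPair, Nat.add_sub_cancel, show n + 2 - 1 = n + 1 by omega,
    show s + 2 - 1 = s + 1 by omega]
  have h' : ((n : ℝ) + 1) * (n.choose s : ℕ) = ((n + 1).choose (s + 1) : ℕ) * ((s : ℝ) + 1) := by
    exact_mod_cast h
  push_cast
  linarith

theorem one_le_thruPair (hs : 2 ≤ s) (hn : s ≤ n) : 1 ≤ thruPair n s := by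
  unfold thruPair
  exact_mod_cast Nat.choose_pos (by omega)

/-- This is where `2 * s ≤ n` enters: it keeps the gap `thru - thruPair`, the smaller eigenvalue of
the unweighted Gram matrix, of the order of `thru`. -/
theorem thruPair_le_half (hs : 2 ≤ s) (hn : 2 * s ≤ n) : thruPair n s ≤ thru n s / 2 := by
  have h := thruPair_mul hs (by omega : 2 ≤ n)
  have h1 : (2 * s : ℝ) ≤ n := by exact_mod_cast hn
  have h2 : (2 : ℝ) ≤ s := by exact_mod_cast hs
  have h3 : (2 * (s - 1) : ℝ) * thruPair n s ≤ (n - 1) * thruPair n s :=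
    mul_le_mul_of_nonneg_right (by linarith) thruPair_nonneg
  have h4 : (0 : ℝ) < s - 1 := by linarith
  have h5 : ((s : ℝ) - 1) * (2 * thruPair n s) ≤ (s - 1) * thru n s := by linarith
  have := le_of_mul_le_mul_left h5 h4
  linarith

/-- An off-diagonal Gram entry is smaller than a diagonal one by a factor of order 1/n. All later
estimates use the exact identity only through this bound. -/
theorem thruPair_mul_le (hs : 2 ≤ s) (hn : 2 * s ≤ n) : thruPair n s * n ≤ s * thru n s := by
  have h := thruPair_mul hs (by omega : 2 ≤ n)
  have h1 := thruPair_le_half hs hn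
  have h2 : 0 ≤ thru n s := thru_nonneg
  linarith

/-- Linear growth is the worst case, attained in order at `s = 2`. It beats the union bound over
vertices in the Hoeffding estimate. -/
theorem div_le_thru (hs : 2 ≤ s) (hn : 2 * s ≤ n) : (n : ℝ) / s ≤ thru n s := by
  have h := thruPair_mul_le hs hn
  have h1 := one_le_thruPair hs (by omega : s ≤ n)
  have h2 : (0 : ℝ) < s := by exact_mod_cast (by omega : 0 < s)
  rw [div_le_iff₀ h2]
  nlinarith [(Nat.cast_nonneg n : (0 : ℝ) ≤ n)]

theorem thru_pos (hs : 2 ≤ s) (hn : 2 * s ≤ n) : 0 < thru n s := by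
  have := one_le_thruPair hs (by omega : s ≤ n)
  have := thruPair_le_half hs hn
  linarith

end Counting

/-! ### The vertex-edge incidence operators `edgeSum` and `vertexSum`. -/

section Sums

variable {n s : ℕ}

theorem edgeSum_eq (x : Fin n → ℝ) (e : SEdge n s) :
    edgeSum x e = ∑ u, if u ∈ e.1 then x u else 0 := by
  simp [edgeSum]

theorem vertexSum_eq (g : SEdge n s → ℝ) (u : Fin n) :
    vertexSum g u = ∑ e : SEdge n s, if u ∈ e.1 then g e else 0 := by
  rw [vertexSum, Finset.sum_filter]

/-- Summation by parts: `edgeSum` and `vertexSum` are adjoint to each other. -/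
theorem sum_mul_edgeSum (g : SEdge n s → ℝ) (x : Fin n → ℝ) :
    ∑ e, g e * edgeSum x e = ∑ u, x u * vertexSum g u := by
  simp_rw [edgeSum_eq, vertexSum_eq, Finset.mul_sum]
  rw [Finset.sum_comm]
  refine Finset.sum_congr rfl fun u _ => Finset.sum_congr rfl fun e _ => ?_
  split_ifs <;> ring

theorem edgeSum_add (x y : Fin n → ℝ) (e : SEdge n s) :
    edgeSum (x + y) e = edgeSum x e + edgeSum y e := by
  simp [edgeSum, Finset.sum_add_distrib]

theorem edgeSum_sub (x y : Fin n → ℝ) (e : SEdge n s) :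
    edgeSum (x - y) e = edgeSum x e - edgeSum y e := by
  simp [edgeSum, Finset.sum_sub_distrib]

theorem edgeSum_smul (a : ℝ) (x : Fin n → ℝ) (e : SEdge n s) :
    edgeSum (a • x) e = a * edgeSum x e := by
  simp [edgeSum, Finset.mul_sum]

theorem edgeSum_single (v : Fin n) (a : ℝ) (e : SEdge n s) :
    edgeSum (Pi.single v a) e = if v ∈ e.1 then a else 0 := by
  simp [edgeSum, Pi.single_apply]

theorem abs_edgeSum_le {x : Fin n → ℝ} {A : ℝ} (hx : ∀ u, |x u| ≤ A) (e : SEdge n s) :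
    |edgeSum x e| ≤ s * A := by
  refine (Finset.abs_sum_le_sum_abs _ _).trans ?_
  refine (Finset.sum_le_card_nsmul _ _ A fun u _ => hx u).trans ?_
  rw [e.2, nsmul_eq_mul]

theorem vertexSum_add (g h : SEdge n s → ℝ) (u : Fin n) :
    vertexSum (fun e => g e + h e) u = vertexSum g u + vertexSum h u := by
  simp [vertexSum, Finset.sum_add_distrib]

theorem vertexSum_sub (g h : SEdge n s → ℝ) (u : Fin n) :
    vertexSum (fun e => g e - h e) u = vertexSum g u - vertexSum h u := by
  simp [vertexSum, Finset.sum_sub_distrib]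

theorem vertexSum_mono {g h : SEdge n s → ℝ} (hgh : ∀ e, g e ≤ h e) (u : Fin n) :
    vertexSum g u ≤ vertexSum h u :=
  Finset.sum_le_sum fun e _ => hgh e

theorem abs_vertexSum_le {g h : SEdge n s → ℝ} (hgh : ∀ e, |g e| ≤ h e) (u : Fin n) :
    |vertexSum g u| ≤ vertexSum h u :=
  (Finset.abs_sum_le_sum_abs _ _).trans (Finset.sum_le_sum fun e _ => hgh e)

theorem vertexSum_const (hs : 1 ≤ s) (a : ℝ) (u : Fin n) :
    vertexSum (fun _ : SEdge n s => a) u = thru n s * a := by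
  rw [vertexSum, Finset.sum_const, nsmul_eq_mul, card_edges_mem hs]

theorem le_vertexSum (hs : 1 ≤ s) {w : SEdge n s → ℝ} {c : ℝ} (hw : ∀ e, c ≤ w e) (u : Fin n) :
    c * thru n s ≤ vertexSum w u := by
  rw [mul_comm, ← vertexSum_const hs]
  exact vertexSum_mono hw u

theorem vertexSum_le (hs : 1 ≤ s) {w : SEdge n s → ℝ} (hw : ∀ e, w e ≤ 1) (u : Fin n) :
    vertexSum w u ≤ thru n s := by
  rw [← mul_one (thru n s), ← vertexSum_const hs]
  exact vertexSum_mono hw u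

/-- Summing the edge sums over all edges through a vertex. -/
theorem vertexSum_edgeSum (hs : 2 ≤ s) (x : Fin n → ℝ) (u : Fin n) :
    vertexSum (fun e : SEdge n s => edgeSum x e) u
      = thru n s * x u + thruPair n s * ∑ w ∈ Finset.univ.erase u, x w := by
  have h : vertexSum (fun e : SEdge n s => edgeSum x e) u
      = ∑ w, x w * ((Finset.univ.filter fun e : SEdge n s => u ∈ e.1 ∧ w ∈ e.1).card : ℝ) := by
    simp_rw [vertexSum, edgeSum_eq]
    rw [Finset.sum_comm]
    refine Finset.sum_congr rfl fun w _ => ?_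
    rw [← Finset.sum_filter, Finset.filter_filter, Finset.sum_const, nsmul_eq_mul, mul_comm]
  rw [h, ← Finset.add_sum_erase _ _ (Finset.mem_univ u), Finset.mul_sum]
  congr 1
  · simp only [and_self]
    rw [card_edges_mem (by omega), mul_comm]
  · refine Finset.sum_congr rfl fun w hw => ?_
    rw [card_edges_mem_mem hs (Finset.ne_of_mem_erase hw).symm, mul_comm]

/-- The unweighted Gram matrix is `(thru - thruPair) I + thruPair J`, with `J` the all-ones matrix.
-/
theorem sum_edgeSum_sq (hs : 2 ≤ s) (x : Fin n → ℝ) :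
    ∑ e : SEdge n s, edgeSum x e ^ 2
      = (thru n s - thruPair n s) * ∑ u, x u ^ 2 + thruPair n s * (∑ u, x u) ^ 2 := by
  simp_rw [sq (edgeSum x _)]
  rw [sum_mul_edgeSum]
  simp_rw [vertexSum_edgeSum hs]
  have h : ∀ u, x u * (thru n s * x u + thruPair n s * ∑ w ∈ Finset.univ.erase u, x w)
      = (thru n s - thruPair n s) * x u ^ 2 + thruPair n s * ((∑ w, x w) * x u) := by
    intro u
    rw [← Finset.add_sum_erase _ _ (Finset.mem_univ u)]
    ring
  simp_rw [h]
  rw [Finset.sum_add_distrib, ← Finset.mul_sum, ← Finset.mul_sum, ← Finset.mul_sum, sq (∑ u, x u)]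

/-- The sum of the squared edge sums through a vertex. -/
theorem vertexSum_edgeSum_sq_le (hs : 2 ≤ s) (x : Fin n → ℝ) (u : Fin n) :
    vertexSum (fun e : SEdge n s => edgeSum x e ^ 2) u
      ≤ s * (thru n s * x u ^ 2 + thruPair n s * ∑ w, x w ^ 2) := by
  have h : vertexSum (fun e : SEdge n s => edgeSum x e ^ 2) u
      ≤ vertexSum (fun e : SEdge n s => s * edgeSum (fun w => x w ^ 2) e) u := by
    refine vertexSum_mono (fun e => ?_) u
    have := sq_sum_le_card_mul_sum_sq (s := e.1) (f := x)
    rw [e.2] at this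
    exact this
  refine h.trans ?_
  have h2 : vertexSum (fun e : SEdge n s => s * edgeSum (fun w => x w ^ 2) e) u
      = s * vertexSum (fun e : SEdge n s => edgeSum (fun w => x w ^ 2) e) u := by
    simp [vertexSum, Finset.mul_sum]
  rw [h2, vertexSum_edgeSum hs]
  refine mul_le_mul_of_nonneg_left ?_ (Nat.cast_nonneg s)
  gcongr
  · exact thruPair_nonneg
  · exact Finset.subset_univ _

end Sums

/-! ### Conditioning and approximate inversion of the weighted Gram matrix. -/

section Gram

variable {n s : ℕ} {w : SEdge n s → ℝ} {c : ℝ}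

theorem sum_mul_gram (w : SEdge n s → ℝ) (x y : Fin n → ℝ) :
    ∑ u, x u * gram w y u = ∑ e, w e * edgeSum y e * edgeSum x e :=
  (sum_mul_edgeSum _ _).symm

theorem sum_mul_gram_comm (w : SEdge n s → ℝ) (x y : Fin n → ℝ) :
    ∑ u, x u * gram w y u = ∑ u, y u * gram w x u := by
  rw [sum_mul_gram, sum_mul_gram]
  exact Finset.sum_congr rfl fun e _ => by ring

/-- Weights at least `c` reduce the quadratic form to the unweighted one, whose `J` part is
nonnegative and can be dropped. -/
theorem le_sum_mul_sq (hs : 2 ≤ s) (hn : 2 * s ≤ n) (hc : 0 ≤ c) (hw : ∀ e, c ≤ w e)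
    (x : Fin n → ℝ) :
    c * thru n s / 2 * ∑ u, x u ^ 2 ≤ ∑ e, w e * edgeSum x e ^ 2 := by
  have h1 : c * ∑ e : SEdge n s, edgeSum x e ^ 2 ≤ ∑ e, w e * edgeSum x e ^ 2 := by
    rw [Finset.mul_sum]
    exact Finset.sum_le_sum fun e _ => mul_le_mul_of_nonneg_right (hw e) (sq_nonneg _)
  refine le_trans ?_ h1
  rw [sum_edgeSum_sq hs]
  have h2 := thruPair_le_half hs hn
  have h3 : 0 ≤ ∑ u, x u ^ 2 := Finset.sum_nonneg fun u _ => sq_nonneg _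
  have h4 : 0 ≤ thruPair n s * (∑ u, x u) ^ 2 := mul_nonneg thruPair_nonneg (sq_nonneg _)
  have h5 : thru n s / 2 * ∑ u, x u ^ 2 ≤ (thru n s - thruPair n s) * ∑ u, x u ^ 2 :=
    mul_le_mul_of_nonneg_right (by linarith) h3
  calc c * thru n s / 2 * ∑ u, x u ^ 2 = c * (thru n s / 2 * ∑ u, x u ^ 2) := by ring
    _ ≤ _ := mul_le_mul_of_nonneg_left (by linarith) hc

theorem le_sum_mul_gram (hs : 2 ≤ s) (hn : 2 * s ≤ n) (hc : 0 ≤ c) (hw : ∀ e, c ≤ w e)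
    (x : Fin n → ℝ) :
    c * thru n s / 2 * ∑ u, x u ^ 2 ≤ ∑ u, x u * gram w x u := by
  rw [sum_mul_gram]
  refine (le_sum_mul_sq hs hn hc hw x).trans (le_of_eq ?_)
  exact Finset.sum_congr rfl fun e _ => by ring

/-- The Gram map is close to its diagonal. -/
theorem abs_gram_sub_le (hs : 2 ≤ s) (hw0 : ∀ e, 0 ≤ w e) (hw1 : ∀ e, w e ≤ 1)
    (x : Fin n → ℝ) (u : Fin n) :
    |gram w x u - vertexSum w u * x u| ≤ thruPair n s * ∑ v, |x v| := by
  have h1 : gram w x u - vertexSum w u * x u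
      = vertexSum (fun e => w e * edgeSum (x - Pi.single u (x u)) e) u := by
    simp only [gram, vertexSum, Finset.sum_mul]
    rw [← Finset.sum_sub_distrib]
    refine Finset.sum_congr rfl fun e he => ?_
    rw [edgeSum_sub, edgeSum_single, if_pos (Finset.mem_filter.1 he).2]
    ring
  rw [h1]
  have h2 : ∀ e : SEdge n s, |w e * edgeSum (x - Pi.single u (x u)) e|
      ≤ edgeSum (fun v => |(x - Pi.single u (x u) : Fin n → ℝ) v|) e := by
    intro e
    rw [abs_mul, abs_of_nonneg (hw0 e)]
    refine (mul_le_of_le_one_left (abs_nonneg _) (hw1 e)).trans ?_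
    exact Finset.abs_sum_le_sum_abs _ _
  refine (abs_vertexSum_le h2 u).trans ?_
  rw [vertexSum_edgeSum hs]
  simp only [Pi.sub_apply, Pi.single_eq_same, sub_self, abs_zero, mul_zero, zero_add]
  refine mul_le_mul_of_nonneg_left ?_ thruPair_nonneg
  calc ∑ v ∈ Finset.univ.erase u, |x v - (Pi.single u (x u) : Fin n → ℝ) v|
      = ∑ v ∈ Finset.univ.erase u, |x v| := by
        refine Finset.sum_congr rfl fun v hv => ?_
        rw [Pi.single_eq_of_ne (Finset.ne_of_mem_erase hv), sub_zero]
    _ ≤ ∑ v, |x v| := by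
        exact Finset.sum_le_sum_of_subset_of_nonneg (Finset.subset_univ _)
          fun v _ _ => abs_nonneg _

theorem sum_abs_sq_le (x : Fin n → ℝ) : (∑ v, |x v|) ^ 2 ≤ n * ∑ v, x v ^ 2 := by
  have := sq_sum_le_card_mul_sum_sq (s := (Finset.univ : Finset (Fin n))) (f := fun v => |x v|)
  simpa using this

theorem le_of_sq_le_mul {a b : ℝ} (hb : 0 ≤ b) (h : a ^ 2 ≤ b * a) : a ≤ b := by
  rcases le_or_gt a 0 with ha | ha
  · linarith
  · nlinarith

/-- Stability of the Gram map in the sup norm: bound of the sum norm. -/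
theorem sum_abs_le_of_gram_le (hs : 2 ≤ s) (hn : 2 * s ≤ n) (hc : 0 < c) (hw : ∀ e, c ≤ w e)
    {z : Fin n → ℝ} {δ : ℝ} (hz : ∀ u, |gram w z u| ≤ δ) (hδ : 0 ≤ δ) :
    ∑ u, |z u| ≤ 2 * n * δ / (c * thru n s) := by
  have hq := thru_pos hs hn
  -- Three bounds on z·Gz and the norms are combined: (cq/2)‖z‖₂² ≤ z·Gz ≤ δ‖z‖₁ and ‖z‖₁² ≤ n‖z‖₂².
  -- Together they bound ‖z‖₁² by a multiple of ‖z‖₁.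
  have h1 := le_sum_mul_gram hs hn hc.le hw z
  have h2 : ∑ u, z u * gram w z u ≤ δ * ∑ u, |z u| := by
    rw [Finset.mul_sum]
    refine Finset.sum_le_sum fun u _ => (le_abs_self _).trans ?_
    rw [abs_mul, mul_comm]
    exact mul_le_mul_of_nonneg_right (hz u) (abs_nonneg _)
  have h3 := sum_abs_sq_le z
  have hcq : 0 < c * thru n s := mul_pos hc hq
  refine le_of_sq_le_mul (by positivity) (h3.trans ?_)
  have h4 : ∑ v, z v ^ 2 ≤ 2 * (δ * ∑ u, |z u|) / (c * thru n s) := by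
    rw [le_div_iff₀ hcq]
    linarith
  calc (n : ℝ) * ∑ v, z v ^ 2 ≤ n * (2 * (δ * ∑ u, |z u|) / (c * thru n s)) :=
        mul_le_mul_of_nonneg_left h4 (Nat.cast_nonneg n)
    _ = _ := by ring

/-- Stability of the Gram map in the sup norm. -/
theorem abs_le_of_gram_le (hs : 2 ≤ s) (hn : 2 * s ≤ n) (hc : 0 < c) (hw : ∀ e, c ≤ w e)
    (hw1 : ∀ e, w e ≤ 1)
    {z : Fin n → ℝ} {δ : ℝ} (hz : ∀ u, |gram w z u| ≤ δ) (hδ : 0 ≤ δ) (u : Fin n) :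
    |z u| ≤ (1 + 2 * s / c) * δ / (c * thru n s) := by
  have hq := thru_pos hs hn
  have hcq : 0 < c * thru n s := mul_pos hc hq
  have h1 := abs_gram_sub_le hs (fun e => hc.le.trans (hw e)) hw1 z u
  have h2 := sum_abs_le_of_gram_le hs hn hc hw hz hδ
  -- The ℓ¹ bound loses a factor n, which the smallness m n ≤ s q of the off-diagonal entries gives
  -- back.
  have h3 : thruPair n s * ∑ v, |z v| ≤ 2 * s / c * δ := by
    calc thruPair n s * ∑ v, |z v| ≤ thruPair n s * (2 * n * δ / (c * thru n s)) :=
          mul_le_mul_of_nonneg_left h2 thruPair_nonneg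
      _ = (thruPair n s * n) * (2 * δ / (c * thru n s)) := by ring
      _ ≤ (s * thru n s) * (2 * δ / (c * thru n s)) :=
          mul_le_mul_of_nonneg_right (thruPair_mul_le hs hn) (by positivity)
      _ = 2 * s / c * δ := by field_simp
  have h4 : vertexSum w u * |z u| ≤ δ + 2 * s / c * δ := by
    have h5 : |vertexSum w u * z u| ≤ |gram w z u| + |gram w z u - vertexSum w u * z u| := by
      have := abs_sub (gram w z u) (gram w z u - vertexSum w u * z u)
      simpa using this
    have h6 : 0 ≤ vertexSum w u := (by positivity : 0 ≤ c * thru n s).trans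
      (le_vertexSum (by omega) hw u)
    rw [abs_mul, abs_of_nonneg h6] at h5
    linarith [hz u]
  rw [le_div_iff₀ hcq, mul_comm]
  calc c * thru n s * |z u| ≤ vertexSum w u * |z u| :=
        mul_le_mul_of_nonneg_right (le_vertexSum (by omega) hw u) (abs_nonneg _)
    _ ≤ _ := by linarith

theorem gram_add (w : SEdge n s → ℝ) (x y : Fin n → ℝ) : gram w (x + y) = gram w x + gram w y := by
  funext u
  simp [gram, edgeSum_add, mul_add, vertexSum_add]

theorem gram_smul (w : SEdge n s → ℝ) (a : ℝ) (x : Fin n → ℝ) : gram w (a • x) = a • gram w x := by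
  funext u
  simp [gram, edgeSum_smul, vertexSum, Finset.mul_sum, mul_left_comm]

/-- The Gram map is onto. -/
theorem exists_gram_eq (hs : 2 ≤ s) (hn : 2 * s ≤ n) (hc : 0 < c) (hw : ∀ e, c ≤ w e)
    (y : Fin n → ℝ) : ∃ x, gram w x = y := by
  let T : (Fin n → ℝ) →ₗ[ℝ] (Fin n → ℝ) :=
    { toFun := gram w, map_add' := gram_add w, map_smul' := gram_smul w }
  have hinj : Function.Injective T := by
    rw [injective_iff_map_eq_zero]
    intro x hx
    have hx' : gram w x = 0 := hx
    have h := sum_abs_le_of_gram_le hs hn hc hw (z := x) (δ := 0) (by simp [hx']) le_rfl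
    have h' : ∑ u, |x u| = 0 :=
      le_antisymm (by simpa using h) (Finset.sum_nonneg fun u _ => abs_nonneg _)
    rw [Finset.sum_eq_zero_iff_of_nonneg fun u _ => abs_nonneg _] at h'
    funext u
    simpa using h' u (Finset.mem_univ u)
  exact LinearMap.injective_iff_surjective.1 hinj y

/-- A column of the inverse Gram matrix, with its leading diagonal entry removed. -/
theorem exists_gram_single (hs : 2 ≤ s) (hn : 2 * s ≤ n) (hc : 0 < c) (hw : ∀ e, c ≤ w e)
    (hw1 : ∀ e, w e ≤ 1) (v : Fin n) :
    ∃ z : Fin n → ℝ, gram w (Pi.single v (vertexSum w v)⁻¹ + z) = Pi.single v 1 ∧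
      ∀ u, |gram w z u| ≤ s / (c * n) := by
  have hq := thru_pos hs hn
  have hcq : 0 < c * thru n s := mul_pos hc hq
  have hav : 0 < vertexSum w v := hcq.trans_le (le_vertexSum (by omega) hw v)
  obtain ⟨y, hy⟩ := exists_gram_eq hs hn hc hw (Pi.single v 1)
  refine ⟨y - Pi.single v (vertexSum w v)⁻¹, by rw [add_sub_cancel, hy], fun u => ?_⟩
  have hn0 : (0 : ℝ) < n := by exact_mod_cast (by omega : 0 < n)
  have h1 : gram w (y - Pi.single v (vertexSum w v)⁻¹) u
      = (Pi.single v 1 : Fin n → ℝ) u - gram w (Pi.single v (vertexSum w v)⁻¹) u := by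
    have := congrFun (gram_add w (y - Pi.single v (vertexSum w v)⁻¹)
      (Pi.single v (vertexSum w v)⁻¹)) u
    rw [sub_add_cancel, hy] at this
    rw [this]
    simp
  rw [h1]
  -- The residual e_v - G(e_v/G_vv) vanishes at v. Elsewhere it is an off-diagonal entry divided by
  -- G_vv, hence at most m/(cq) ≤ s/(cn).
  rcases eq_or_ne u v with rfl | huv
  · have h2 : gram w (Pi.single u (vertexSum w u)⁻¹) u = 1 := by
      have : gram w (Pi.single u (vertexSum w u)⁻¹) u = vertexSum w u * (vertexSum w u)⁻¹ := by
        simp only [gram, vertexSum, Finset.sum_mul]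
        refine Finset.sum_congr rfl fun e he => ?_
        rw [edgeSum_single, if_pos (Finset.mem_filter.1 he).2]
      rw [this, mul_inv_cancel₀ hav.ne']
    rw [h2, Pi.single_eq_same, sub_self, abs_zero]
    positivity
  · have h2 := abs_gram_sub_le hs (fun e => hc.le.trans (hw e)) hw1
      (Pi.single v (vertexSum w v)⁻¹) u
    rw [Pi.single_eq_of_ne huv, mul_zero, sub_zero] at h2
    have h3 : ∑ x, |(Pi.single v (vertexSum w v)⁻¹ : Fin n → ℝ) x| = (vertexSum w v)⁻¹ := by
      rw [Finset.sum_eq_single v]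
      · rw [Pi.single_eq_same, abs_of_pos (inv_pos.2 hav)]
      · intro b _ hb
        rw [Pi.single_eq_of_ne hb, abs_zero]
      · simp
    rw [h3] at h2
    rw [Pi.single_eq_of_ne huv, zero_sub, abs_neg]
    refine h2.trans ?_
    rw [← div_eq_mul_inv]
    calc thruPair n s / vertexSum w v ≤ thruPair n s / (c * thru n s) :=
          div_le_div_of_nonneg_left thruPair_nonneg hcq (le_vertexSum (by omega) hw v)
      _ ≤ s / (c * n) := by
          rw [div_le_div_iff₀ hcq (by positivity)]
          have := thruPair_mul_le hs hn
          nlinarith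

end Gram

/-! ### The logistic function and its cumulant function. -/

section Logistic

/-- The logistic function. -/
noncomputable def logistic (x : ℝ) : ℝ := Real.exp x / (1 + Real.exp x)

/-- The cumulant function of the logistic family. -/
noncomputable def logPartition (x : ℝ) : ℝ := Real.log (1 + Real.exp x)

theorem logistic_pos (x : ℝ) : 0 < logistic x := by
  unfold logistic; positivity

theorem one_sub_logistic (x : ℝ) : 1 - logistic x = 1 / (1 + Real.exp x) := by
  unfold logistic
  have := Real.exp_pos x
  field_simp
  ring

theorem logistic_lt_one (x : ℝ) : logistic x < 1 := by
  have h : 0 < 1 - logistic x := by rw [one_sub_logistic]; positivity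
  linarith

theorem hasDerivAt_logPartition (x : ℝ) : HasDerivAt logPartition (logistic x) x := by
  have h : HasDerivAt (fun x => 1 + Real.exp x) (Real.exp x) x :=
    (Real.hasDerivAt_exp x).const_add 1
  exact h.log (by positivity)

theorem hasDerivAt_logistic (x : ℝ) :
    HasDerivAt logistic (logistic x * (1 - logistic x)) x := by
  have h : HasDerivAt (fun x => 1 + Real.exp x) (Real.exp x) x :=
    (Real.hasDerivAt_exp x).const_add 1
  have h2 := (Real.hasDerivAt_exp x).div h (by positivity)
  convert! h2 using 1
  rw [one_sub_logistic, logistic]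
  have := Real.exp_pos x
  field_simp
  ring

theorem logistic_mul_one_sub_le_one (x : ℝ) : logistic x * (1 - logistic x) ≤ 1 := by
  have h0 := logistic_pos x
  have h1 := logistic_lt_one x
  nlinarith

theorem logistic_mul_one_sub_pos (x : ℝ) : 0 < logistic x * (1 - logistic x) :=
  mul_pos (logistic_pos x) (sub_pos.2 (logistic_lt_one x))

/-- A lower bound for the derivative of the logistic function on `[-A, A]`. -/
noncomputable def curvature (A : ℝ) : ℝ := 1 / (2 + 2 * Real.exp A)

theorem curvature_pos (A : ℝ) : 0 < curvature A := by
  unfold curvature; positivity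

/-- The derivative equals 1/(2 + eˣ + e⁻ˣ), and both exponentials are at most `exp A`. -/
theorem curvature_le {A x : ℝ} (hx : |x| ≤ A) :
    curvature A ≤ logistic x * (1 - logistic x) := by
  rw [one_sub_logistic, logistic, curvature]
  have h0 := Real.exp_pos x
  have h1 : Real.exp x ≤ Real.exp A := Real.exp_le_exp.2 (abs_le.1 hx).2
  have h2 : Real.exp (-x) ≤ Real.exp A := Real.exp_le_exp.2 (by linarith [(abs_le.1 hx).1])
  have h3 : Real.exp x * Real.exp (-x) = 1 := by rw [← Real.exp_add]; simp
  rw [div_mul_div_comm, div_le_div_iff₀ (by positivity) (by positivity)]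
  nlinarith

theorem exists_logistic_sub_eq (a b : ℝ) :
    ∃ x, |x| ≤ max |a| |b| ∧
      logistic b - logistic a = logistic x * (1 - logistic x) * (b - a) := by
  rcases lt_trichotomy a b with h | h | h
  · obtain ⟨x, hx, hxe⟩ := exists_hasDerivAt_eq_slope logistic _ h
      (fun y _ => (hasDerivAt_logistic y).continuousAt.continuousWithinAt)
      (fun y _ => hasDerivAt_logistic y)
    refine ⟨x, abs_le_max_abs_abs hx.1.le hx.2.le, ?_⟩
    rw [hxe, div_mul_cancel₀ _ (by linarith)]
  · exact ⟨a, le_max_left _ _, by simp [h]⟩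
  · obtain ⟨x, hx, hxe⟩ := exists_hasDerivAt_eq_slope logistic _ h
      (fun y _ => (hasDerivAt_logistic y).continuousAt.continuousWithinAt)
      (fun y _ => hasDerivAt_logistic y)
    refine ⟨x, (abs_le_max_abs_abs hx.1.le hx.2.le).trans (max_comm _ _).le, ?_⟩
    rw [hxe, ← neg_sub a b, mul_neg, div_mul_cancel₀ _ (by linarith)]
    ring

theorem abs_logistic_sub_le (a b : ℝ) : |logistic b - logistic a| ≤ |b - a| := by
  obtain ⟨x, -, hx⟩ := exists_logistic_sub_eq a b
  rw [hx, abs_mul, abs_of_pos (logistic_mul_one_sub_pos x)]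
  exact mul_le_of_le_one_left (abs_nonneg _) (logistic_mul_one_sub_le_one x)

/-- Second-order Taylor bound for the logistic function. -/
theorem abs_logistic_taylor_le (a b : ℝ) :
    |logistic b - logistic a - logistic a * (1 - logistic a) * (b - a)| ≤ (b - a) ^ 2 := by
  -- The derivative p(1 - p) is 1-Lipschitz, since p(1 - p) - q(1 - q) = (p - q)(1 - p - q). The
  -- mean value inequality for the function minus its linear part then gives the quadratic bound.
  have key : ∀ x ∈ Set.uIcc a b,
      |logistic x * (1 - logistic x) - logistic a * (1 - logistic a)| ≤ |b - a| := by
    intro x hx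
    have h1 : logistic x * (1 - logistic x) - logistic a * (1 - logistic a)
        = (logistic x - logistic a) * (1 - logistic x - logistic a) := by ring
    have h2 : |1 - logistic x - logistic a| ≤ 1 := by
      have := logistic_pos x
      have := logistic_pos a
      have := logistic_lt_one x
      have := logistic_lt_one a
      rw [abs_le]; constructor <;> linarith
    rw [h1, abs_mul]
    exact (mul_le_of_le_one_right (abs_nonneg _) h2).trans
      ((abs_logistic_sub_le a x).trans (Set.abs_sub_left_of_mem_uIcc hx))
  have h := Convex.norm_image_sub_le_of_norm_hasDerivWithin_le
    (f := fun x => logistic x - logistic a * (1 - logistic a) * x)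
    (f' := fun x => logistic x * (1 - logistic x) - logistic a * (1 - logistic a))
    (s := Set.uIcc a b) (C := |b - a|) (x := a) (y := b)
    (fun x _ => by
      have h1 := ((hasDerivAt_logistic x).sub
        ((hasDerivAt_id x).const_mul (logistic a * (1 - logistic a)))).hasDerivWithinAt
          (s := Set.uIcc a b)
      rw [mul_one] at h1
      exact h1)
    key (convex_uIcc a b) Set.left_mem_uIcc Set.right_mem_uIcc
  rw [Real.norm_eq_abs, Real.norm_eq_abs] at h
  calc _ = |logistic b - logistic a * (1 - logistic a) * b
        - (logistic a - logistic a * (1 - logistic a) * a)| := by congr 1; ring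
    _ ≤ _ := h
    _ = _ := by rw [← sq, sq_abs]

theorem logistic_strictMono : StrictMono logistic :=
  strictMono_of_hasDerivAt_pos hasDerivAt_logistic logistic_mul_one_sub_pos

/-- The derivative is the increasing logistic function, so the function is convex and lies above its
tangents. -/
theorem logPartition_ge (a b : ℝ) :
    logPartition a + logistic a * (b - a) ≤ logPartition b := by
  have hconv : ConvexOn ℝ Set.univ logPartition := by
    refine MonotoneOn.convexOn_of_deriv convex_univ
      (fun x _ => (hasDerivAt_logPartition x).continuousAt.continuousWithinAt)
      (fun x _ => (hasDerivAt_logPartition x).differentiableAt.differentiableWithinAt) ?_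
    have : deriv logPartition = logistic := funext fun x => (hasDerivAt_logPartition x).deriv
    rw [this]
    exact logistic_strictMono.monotone.monotoneOn _
  rcases lt_trichotomy a b with h | h | h
  · have := hconv.le_slope_of_hasDerivAt (Set.mem_univ a) (Set.mem_univ b) h
      (hasDerivAt_logPartition a)
    rw [slope_def_field, le_div_iff₀ (by linarith)] at this
    linarith
  · simp [h]
  · have := hconv.slope_le_of_hasDerivAt (Set.mem_univ b) (Set.mem_univ a) h
      (hasDerivAt_logPartition a)
    rw [slope_def_field, div_le_iff₀ (by linarith)] at this
    linarith

end Logistic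

/-! ### Concavity, first-order conditions and uniqueness for one layer. -/

section LogLikelihood

variable {n s : ℕ}

/-- The log-likelihood of one layer, with edge observations `X`. -/
noncomputable def logLik (X : SEdge n s → ℝ) (b : Fin n → ℝ) : ℝ :=
  ∑ e, (X e * edgeSum b e - logPartition (edgeSum b e))

/-- The gradient of the log-likelihood of one layer: the centred degrees. -/
noncomputable def score (X : SEdge n s → ℝ) (b : Fin n → ℝ) (u : Fin n) : ℝ :=
  vertexSum (fun e => X e - logistic (edgeSum b e)) u

/-- Concavity of the log-likelihood in tangent form: a zero of the score is a global maximizer. -/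
theorem logLik_le (X : SEdge n s → ℝ) (b b' : Fin n → ℝ) :
    logLik X b' ≤ logLik X b + ∑ u, (b' - b) u * score X b u := by
  simp only [score]
  rw [← sum_mul_edgeSum, logLik, logLik, ← Finset.sum_add_distrib]
  refine Finset.sum_le_sum fun e _ => ?_
  have := logPartition_ge (edgeSum b e) (edgeSum b' e)
  rw [edgeSum_sub]
  linarith

theorem continuous_edgeSum (e : SEdge n s) : Continuous fun b : Fin n → ℝ => edgeSum b e :=
  continuous_finsetSum _ fun u _ => continuous_apply u

theorem continuous_logLik (X : SEdge n s → ℝ) : Continuous (logLik X) := by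
  have h : Continuous logPartition := continuous_iff_continuousAt.2
    fun x => (hasDerivAt_logPartition x).continuousAt
  exact continuous_finsetSum _ fun e _ =>
    ((continuous_edgeSum e).const_mul _).sub (h.comp (continuous_edgeSum e))

theorem hasDerivAt_logLik (X : SEdge n s → ℝ) (b d : Fin n → ℝ) :
    HasDerivAt (fun t : ℝ => logLik X (b + t • d)) (∑ u, d u * score X b u) 0 := by
  simp only [score]
  rw [← sum_mul_edgeSum]
  refine HasDerivAt.fun_sum fun e _ => ?_
  have h1 : HasDerivAt (fun t : ℝ => edgeSum (b + t • d) e) (edgeSum d e) 0 := by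
    simp_rw [edgeSum_add, edgeSum_smul]
    simpa using ((hasDerivAt_id (0 : ℝ)).mul_const (edgeSum d e)).const_add (edgeSum b e)
  have h2 : HasDerivAt logPartition (logistic (edgeSum b e)) (edgeSum (b + (0 : ℝ) • d) e) := by
    simpa using hasDerivAt_logPartition (edgeSum b e)
  convert! (h1.const_mul (X e)).sub (h2.comp 0 h1) using 1
  ring

/-- First-order condition at a point that is maximal in a feasible direction. -/
theorem sum_mul_score_nonpos {X : SEdge n s → ℝ} {b d : Fin n → ℝ}
    (h : ∀ t ∈ Set.Ioo (0 : ℝ) 1, logLik X (b + t • d) ≤ logLik X b) :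
    ∑ u, d u * score X b u ≤ 0 := by
  have hd := (hasDerivAt_logLik X b d).hasDerivWithinAt (s := Set.Ioi 0)
  rw [hasDerivWithinAt_iff_tendsto_slope' (by simp)] at hd
  refine le_of_tendsto hd ?_
  filter_upwards [Ioo_mem_nhdsGT (zero_lt_one' ℝ)] with t ht
  rw [slope_def_field]
  refine div_nonpos_of_nonpos_of_nonneg ?_ (by linarith [ht.1])
  have := h t ht
  simpa using this

theorem score_eq_zero_of_isMax {X : SEdge n s → ℝ} {b : Fin n → ℝ}
    (h : ∀ b', logLik X b' ≤ logLik X b) (u : Fin n) : score X b u = 0 := by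
  have h1 := sum_mul_score_nonpos (X := X) (b := b) (d := Pi.single u 1) fun t _ => h _
  have h2 := sum_mul_score_nonpos (X := X) (b := b) (d := -Pi.single u 1) fun t _ => h _
  simp [Pi.single_apply] at h1 h2
  linarith

/-- The difference of the scores is a Gram map, with weights bounded below on bounded sets. -/
theorem exists_score_sub_eq {M : ℝ} {X : SEdge n s → ℝ} {b b' : Fin n → ℝ}
    (hb : ∀ u, |b u| ≤ M) (hb' : ∀ u, |b' u| ≤ M) :
    ∃ w : SEdge n s → ℝ, (∀ e, curvature (s * M) ≤ w e) ∧ (∀ e, w e ≤ 1) ∧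
      ∀ u, score X b u - score X b' u = gram w (b' - b) u := by
  choose x hx hxe using fun e : SEdge n s => exists_logistic_sub_eq (edgeSum b e) (edgeSum b' e)
  refine ⟨fun e => logistic (x e) * (1 - logistic (x e)), fun e => curvature_le ?_,
    fun e => logistic_mul_one_sub_le_one _, fun u => ?_⟩
  · exact (hx e).trans (max_le (abs_edgeSum_le hb e) (abs_edgeSum_le hb' e))
  · rw [score, score, ← vertexSum_sub, gram]
    congr 1
    funext e
    rw [edgeSum_sub, ← hxe]
    ring

/-- The difference of the two scores is a Gram map with weights bounded below, and such a map is
injective. -/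
theorem eq_of_score_eq_zero (hs : 2 ≤ s) (hn : 2 * s ≤ n) {X : SEdge n s → ℝ} {b b' : Fin n → ℝ}
    (h : ∀ u, score X b u = 0) (h' : ∀ u, score X b' u = 0) : b = b' := by
  -- Any bound serves here, even one depending on the two points: only positivity of the resulting
  -- curvature matters.
  obtain ⟨M, hM⟩ : ∃ M, ∀ u, |b u| ≤ M ∧ |b' u| ≤ M := by
    refine ⟨∑ u, (|b u| + |b' u|), fun u => ?_⟩
    have := Finset.single_le_sum (f := fun u => |b u| + |b' u|)
      (fun v _ => add_nonneg (abs_nonneg _) (abs_nonneg _)) (Finset.mem_univ u)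
    constructor <;> linarith [abs_nonneg (b u), abs_nonneg (b' u)]
  obtain ⟨w, hw, -, hg⟩ := exists_score_sub_eq (X := X) (fun u => (hM u).1) (fun u => (hM u).2)
  have h0 := sum_abs_le_of_gram_le hs hn (curvature_pos _) hw (z := b' - b) (δ := 0)
    (fun u => by rw [← hg, h, h']; simp) le_rfl
  have h1 : ∑ u, |(b' - b) u| = 0 :=
    le_antisymm (by simpa using h0) (Finset.sum_nonneg fun u _ => abs_nonneg _)
  rw [Finset.sum_eq_zero_iff_of_nonneg fun u _ => abs_nonneg _] at h1
  funext u
  have := h1 u (Finset.mem_univ u)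
  simp only [Pi.sub_apply, abs_eq_zero] at this
  linarith

end LogLikelihood

/-! ### Deterministic error bounds, existence of a maximizer and linearization. -/

section Deterministic

variable {n s : ℕ} {M K : ℝ} {X : SEdge n s → ℝ} {b b' : Fin n → ℝ}

theorem abs_le_add_one (hb : ∀ u, |b u| ≤ M) (hbb : ∀ u, |(b' - b) u| ≤ 1) (u : Fin n) :
    |b' u| ≤ M + 1 := by
  have h1 := hb u
  have h2 := hbb u
  rw [Pi.sub_apply, abs_le] at h2
  rw [abs_le] at h1 ⊢
  constructor <;> linarith

/-- Strong concavity on the unit box compared with Cauchy–Schwarz for the score at `b`. The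
condition `hopt` is weaker than `score X b' = 0`, so that the bound also applies to a maximizer
constrained to the box. -/
theorem sum_sq_le_of_score (hs : 2 ≤ s) (hn : 2 * s ≤ n) (hb : ∀ u, |b u| ≤ M)
    (hbb : ∀ u, |(b' - b) u| ≤ 1) (hopt : 0 ≤ ∑ u, (b' - b) u * score X b' u)
    (hD : ∑ u, score X b u ^ 2 ≤ K * n * thru n s) :
    thru n s * ∑ u, (b' - b) u ^ 2 ≤ 4 * K * n / curvature (s * (M + 1)) ^ 2 := by
  obtain ⟨w, hw, hw1, hg⟩ := exists_score_sub_eq (X := X) (M := M + 1) (b := b) (b' := b')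
    (fun u => (hb u).trans (by linarith)) (abs_le_add_one hb hbb)
  set c := curvature (s * (M + 1)) with hcdef
  have hc : 0 < c := curvature_pos _
  have hq := thru_pos hs hn
  set Ψ := ∑ u, (b' - b) u ^ 2 with hΨ
  have hΨ0 : 0 ≤ Ψ := Finset.sum_nonneg fun u _ => sq_nonneg _
  have h1 : c * thru n s / 2 * Ψ ≤ ∑ u, (b' - b) u * score X b u := by
    refine (le_sum_mul_gram hs hn hc.le hw (b' - b)).trans ?_
    simp_rw [← hg, mul_sub]
    rw [Finset.sum_sub_distrib]
    linarith
  have h2 : (c * thru n s / 2 * Ψ) ^ 2 ≤ Ψ * (K * n * thru n s) :=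
    calc (c * thru n s / 2 * Ψ) ^ 2 ≤ (∑ u, (b' - b) u * score X b u) ^ 2 :=
          pow_le_pow_left₀ (by positivity) h1 2
      _ ≤ Ψ * ∑ u, score X b u ^ 2 := Finset.sum_mul_sq_le_sq_mul_sq _ _ _
      _ ≤ _ := mul_le_mul_of_nonneg_left hD hΨ0
  have hK : 0 ≤ K * n * thru n s := (Finset.sum_nonneg fun u _ => sq_nonneg _).trans hD
  have hK' : 0 ≤ K * n := by
    by_contra h
    exact absurd hK (not_le.2 (mul_neg_of_neg_of_pos (not_le.1 h) hq))
  -- The inequality `h2` is quadratic in Ψ on the left and linear on the right; dividing by Ψ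
  -- requires it to be nonzero.
  rcases hΨ0.eq_or_lt with h0 | h0
  · rw [← h0, mul_zero]
    have : 4 * K * n = 4 * (K * n) := by ring
    rw [this]
    positivity
  · rw [le_div_iff₀ (by positivity)]
    have h3 : (thru n s * Ψ * c ^ 2) * (thru n s * Ψ) ≤ (4 * K * n) * (thru n s * Ψ) := by
      calc _ = 4 * (c * thru n s / 2 * Ψ) ^ 2 := by ring
        _ ≤ 4 * (Ψ * (K * n * thru n s)) := by linarith
        _ = _ := by ring
    exact le_of_mul_le_mul_right h3 (by positivity)

/-- The off-diagonal part of the Gram map is at most m‖Δ‖₁ ≤ m√n‖Δ‖₂ for Δ = b' - b. The ℓ² bound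
and m n ≤ s q make this O(√(Kq)), negligible against the diagonal. The coordinates thus decouple,
which is how ℓ² control becomes coordinatewise. -/
theorem abs_diag_sub_le (hs : 2 ≤ s) (hn : 2 * s ≤ n) (hb : ∀ u, |b u| ≤ M)
    (hbb : ∀ u, |(b' - b) u| ≤ 1) (hopt : 0 ≤ ∑ u, (b' - b) u * score X b' u) (hK : 0 ≤ K)
    (hD : ∑ u, score X b u ^ 2 ≤ K * n * thru n s) :
    ∃ a : Fin n → ℝ, (∀ u, curvature (s * (M + 1)) * thru n s ≤ a u) ∧
      ∀ u, |score X b u - score X b' u - a u * (b' - b) u|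
        ≤ 2 * s / curvature (s * (M + 1)) * √(K * thru n s) := by
  have hΨ := sum_sq_le_of_score hs hn hb hbb hopt hD
  obtain ⟨w, hw, hw1, hg⟩ := exists_score_sub_eq (X := X) (M := M + 1) (b := b) (b' := b')
    (fun u => (hb u).trans (by linarith)) (abs_le_add_one hb hbb)
  set c := curvature (s * (M + 1)) with hcdef
  have hc : 0 < c := curvature_pos _
  have hq := thru_pos hs hn
  refine ⟨vertexSum w, fun u => le_vertexSum (by omega) hw u, fun u => ?_⟩
  rw [hg]
  refine (abs_gram_sub_le hs (fun e => hc.le.trans (hw e)) hw1 _ u).trans ?_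
  refine abs_le_of_sq_le_sq' ?_ (by positivity) |>.2
  have h1 := sum_abs_sq_le (b' - b)
  have hm := thruPair_mul_le hs hn
  have hm0 : 0 ≤ thruPair n s := thruPair_nonneg
  have h2 : (thruPair n s * n) ^ 2 ≤ (s * thru n s) ^ 2 := pow_le_pow_left₀ (by positivity) hm 2
  rw [mul_pow, mul_pow, Real.sq_sqrt (by positivity)]
  have h3 : thru n s * (thruPair n s ^ 2 * (∑ v, |(b' - b) v|) ^ 2)
      ≤ thru n s * ((2 * s / c) ^ 2 * (K * thru n s)) :=
    calc _ ≤ thru n s * (thruPair n s ^ 2 * (n * ∑ v, (b' - b) v ^ 2)) := by gcongr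
      _ = thruPair n s ^ 2 * n * (thru n s * ∑ v, (b' - b) v ^ 2) := by ring
      _ ≤ thruPair n s ^ 2 * n * (4 * K * n / c ^ 2) := by gcongr
      _ = (thruPair n s * n) ^ 2 * (4 * K / c ^ 2) := by ring
      _ ≤ (s * thru n s) ^ 2 * (4 * K / c ^ 2) := by gcongr
      _ = _ := by ring
  exact le_of_mul_le_mul_left h3 hq

/-- If the centred degrees are small then the log-likelihood has a maximizer close to the true
parameter. -/
theorem exists_isMax_near (hs : 2 ≤ s) (hn : 2 * s ≤ n) (hb : ∀ u, |b u| ≤ M) (hK : 0 ≤ K)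
    (hD : ∑ u, score X b u ^ 2 ≤ K * n * thru n s)
    (hDm : ∀ u, |score X b u| ≤ curvature (s * (M + 1)) * thru n s / 2)
    (hlarge : 2 * s / curvature (s * (M + 1)) * √(K * thru n s)
      < curvature (s * (M + 1)) * thru n s / 2) :
    ∃ b' : Fin n → ℝ, (∀ b'', logLik X b'' ≤ logLik X b') ∧ ∀ u, |(b' - b) u| ≤ 1 := by
  have hbox : ∀ x : Fin n → ℝ, x ∈ Metric.closedBall b 1 ↔ ∀ u, |(x - b) u| ≤ 1 := by
    intro x
    rw [Metric.mem_closedBall, dist_pi_le_iff zero_le_one]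
    rfl
  -- Compactness yields a maximizer on the unit box only; it remains to show that it is interior.
  obtain ⟨b', hb'mem, hmax⟩ := (isCompact_closedBall b 1).exists_isMaxOn
    ⟨b, Metric.mem_closedBall_self zero_le_one⟩ (continuous_logLik X).continuousOn
  have hbb := (hbox b').1 hb'mem
  have hdir : ∀ d : Fin n → ℝ, (∀ u, |(b' + d - b) u| ≤ 1) → ∑ u, d u * score X b' u ≤ 0 := by
    intro d hd
    refine sum_mul_score_nonpos fun t ht => hmax ?_
    have hconv := convex_closedBall b 1
    have := hconv.add_smul_mem hb'mem ((hbox (b' + d)).2 hd) ⟨ht.1.le, ht.2.le⟩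
    exact this
  -- Moving straight back towards the centre `b` is a feasible direction.
  have hopt : 0 ≤ ∑ u, (b' - b) u * score X b' u := by
    have := hdir (-(b' - b)) (fun u => by simp)
    simp only [Pi.neg_apply, neg_mul, Finset.sum_neg_distrib] at this
    linarith
  have hcoord : ∀ u (a : ℝ), |(b' - b) u + a| ≤ 1 → a * score X b' u ≤ 0 := by
    intro u a ha
    have := hdir (Pi.single u a) fun v => by
      rcases eq_or_ne v u with rfl | hvu
      · have h : (b' + (Pi.single v a : Fin n → ℝ) - b) v = (b' - b) v + a := by simp; ring
        rw [h]; exact ha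
      · have h : (b' + (Pi.single u a : Fin n → ℝ) - b) v = (b' - b) v := by simp [Pi.single_eq_of_ne hvu]
        rw [h]; exact hbb v
    rwa [Finset.sum_eq_single u, Pi.single_eq_same] at this
    · intro v _ hv
      rw [Pi.single_eq_of_ne hv, zero_mul]
    · simp
  obtain ⟨a, ha, hest⟩ := abs_diag_sub_le hs hn hb hbb hopt hK hD
  set c := curvature (s * (M + 1)) with hcdef
  -- At a boundary coordinate the score of `b'` points outwards or vanishes, so the centred degree
  -- at `b` has absolute value at least c q minus the off-diagonal error. By `hlarge` this exceeds c
  -- q / 2, against `hDm`.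
  have hlt : ∀ u, |(b' - b) u| < 1 := by
    intro u
    refine lt_of_le_of_ne (hbb u) fun h1 => ?_
    have h2 := hcoord u (-(b' - b) u) (by simp)
    have h3 := abs_le.1 (hest u)
    have h4 := abs_le.1 (hDm u)
    have h5 := ha u
    rcases (abs_eq zero_le_one).1 h1 with h | h <;> rw [h] at h2 h3 <;> linarith
  -- At an interior point both signs of a small coordinate step are feasible.
  have hzero : ∀ u, score X b' u = 0 := by
    intro u
    have hp : 0 < 1 - |(b' - b) u| := sub_pos.2 (hlt u)
    have h1 := hcoord u (1 - |(b' - b) u|) ((abs_add_le _ _).trans (by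
      rw [abs_of_pos hp]; linarith))
    have h2 := hcoord u (-(1 - |(b' - b) u|)) ((abs_add_le _ _).trans (by
      rw [abs_neg, abs_of_pos hp]; linarith))
    nlinarith
  refine ⟨b', fun b'' => ?_, hbb⟩
  refine (logLik_le X b' b'').trans ?_
  simp [hzero]

/-- The constant in the error bound of `abs_linearization_le`. -/
noncomputable def linConst (s : ℕ) (c : ℝ) : ℝ :=
  s * ((1 + 2 * s / c) ^ 2 / c ^ 2 + 4 * s / c ^ 2) / c
    + (1 + 2 * s / c) * s * (s * (1 + s)) * 4 / c ^ 4

/-- The variance of an edge indicator. -/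
noncomputable def edgeVar (b : Fin n → ℝ) (e : SEdge n s) : ℝ :=
  logistic (edgeSum b e) * (1 - logistic (edgeSum b e))

theorem edgeVar_le_one (b : Fin n → ℝ) (e : SEdge n s) : edgeVar b e ≤ 1 :=
  logistic_mul_one_sub_le_one _

theorem edgeVar_nonneg (b : Fin n → ℝ) (e : SEdge n s) : 0 ≤ edgeVar b e :=
  (logistic_mul_one_sub_pos _).le

/-- The bound is stated with `M + 1` so that one constant serves both the true parameter and the
whole unit box around it. -/
theorem curvature_le_edgeVar (hb : ∀ u, |b u| ≤ M) (e : SEdge n s) :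
    curvature (s * (M + 1)) ≤ edgeVar b e :=
  curvature_le (abs_edgeSum_le (fun u => (hb u).trans (by linarith)) e)

/-- As the score vanishes at `b'`, the score at `b` is a sum of logistic increments. Their linear
part is the Gram map, and the quadratic Taylor remainders are summed through the vertex. -/
theorem abs_score_sub_gram_le (hs : 2 ≤ s) (hzero : ∀ u, score X b' u = 0) (u : Fin n) :
    |score X b u - gram (s := s) (edgeVar b) (b' - b) u|
      ≤ s * (thru n s * (b' - b) u ^ 2 + thruPair n s * ∑ w, (b' - b) w ^ 2) := by
  have h : score X b u
      - gram (s := s) (edgeVar b) (b' - b) u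
      = vertexSum (fun e : SEdge n s => logistic (edgeSum b' e) - logistic (edgeSum b e)
        - logistic (edgeSum b e) * (1 - logistic (edgeSum b e))
          * (edgeSum b' e - edgeSum b e)) u := by
    have h0 := hzero u
    rw [← sub_zero (score X b u), ← h0, score, score, ← vertexSum_sub, gram, ← vertexSum_sub]
    congr 1
    funext e
    rw [edgeSum_sub, edgeVar]
    ring
  rw [h]
  refine (abs_vertexSum_le (fun e => abs_logistic_taylor_le _ _) u).trans ?_
  refine le_trans (le_of_eq ?_) (vertexSum_edgeSum_sq_le hs (b' - b) u)
  congr 1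
  funext e
  rw [edgeSum_sub]

/-- Linearization of the likelihood equations: up to an error of order `(thru n s)^(-1/2)`, the
normalized estimation error is the normalized centred degree plus a small linear statistic. -/
theorem abs_linearization_le (hs : 2 ≤ s) (hn : 2 * s ≤ n) (hb : ∀ u, |b u| ≤ M) (hK : 0 ≤ K)
    (hD : ∑ u, score X b u ^ 2 ≤ K * n * thru n s) (hbb : ∀ u, |(b' - b) u| ≤ 1)
    (hzero : ∀ u, score X b' u = 0) {v : Fin n} (hDv : score X b v ^ 2 ≤ K * thru n s)
    {a : ℝ} {w : SEdge n s → ℝ}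
    (hw : w = edgeVar b)
    (ha : a = vertexSum w v) {z : Fin n → ℝ}
    (hz : gram w (Pi.single v (vertexSum w v)⁻¹ + z) = Pi.single v 1)
    (hz' : ∀ u, |gram w z u| ≤ s / (curvature (s * (M + 1)) * n)) :
    |√a * (b' - b) v - score X b v / √a - √a * ∑ u, z u * score X b u|
      ≤ linConst s (curvature (s * (M + 1))) * K / √(thru n s) := by
  have hopt : 0 ≤ ∑ u, (b' - b) u * score X b' u := by simp [hzero]
  have hΨ := sum_sq_le_of_score hs hn hb hbb hopt hD
  obtain ⟨a', ha', hest⟩ := abs_diag_sub_le hs hn hb hbb hopt hK hD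
  have hR := abs_score_sub_gram_le (b := b) hs hzero
  rw [← hw] at hR
  have hwc : ∀ e, curvature (s * (M + 1)) ≤ w e := by
    rw [hw]
    exact curvature_le_edgeVar hb
  have hw1 : ∀ e, w e ≤ 1 := by
    rw [hw]
    exact edgeVar_le_one b
  set c := curvature (s * (M + 1)) with hcdef
  have hc : 0 < c := curvature_pos _
  have hq := thru_pos hs hn
  have hn0 : (0 : ℝ) < n := by exact_mod_cast (by omega : 0 < n)
  have hs0 : (0 : ℝ) ≤ s := Nat.cast_nonneg s
  set q := thru n s with hqdef
  set m := thruPair n s with hmdef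
  have hm0 : 0 ≤ m := thruPair_nonneg
  have hmn : m * n ≤ s * q := thruPair_mul_le hs hn
  set Ψ := ∑ u, (b' - b) u ^ 2 with hΨdef
  have hΨ0 : 0 ≤ Ψ := Finset.sum_nonneg fun u _ => sq_nonneg _
  have hca : c * q ≤ a := ha ▸ le_vertexSum (by omega) hwc v
  have haq : a ≤ q := ha ▸ vertexSum_le (by omega) hw1 v
  have ha0 : 0 < a := (mul_pos hc hq).trans_le hca
  have hmΨ : m * Ψ ≤ 4 * K * s / c ^ 2 := by
    have h1 : q * (m * Ψ) ≤ q * (4 * K * s / c ^ 2) :=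
      calc q * (m * Ψ) = m * (q * Ψ) := by ring
        _ ≤ m * (4 * K * n / c ^ 2) := by gcongr
        _ = (m * n) * (4 * K / c ^ 2) := by ring
        _ ≤ (s * q) * (4 * K / c ^ 2) := by gcongr
        _ = _ := by ring
    exact le_of_mul_le_mul_left h1 hq
  -- The diagonal estimate at the one coordinate v, where the centred degree is known to be
  -- O(√(Kq)).
  have hΔv : q * (b' - b) v ^ 2 ≤ K * ((1 + 2 * s / c) ^ 2 / c ^ 2) := by
    have h1 : c * q * |(b' - b) v| ≤ (1 + 2 * s / c) * √(K * q) := by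
      have h2 := hest v
      rw [hzero, sub_zero] at h2
      have h3 : |score X b v| ≤ √(K * q) := Real.abs_le_sqrt hDv
      have h4 : |a' v * (b' - b) v| ≤ |score X b v| + |score X b v - a' v * (b' - b) v| := by
        have := abs_sub (score X b v) (score X b v - a' v * (b' - b) v)
        simpa using this
      have h5 : c * q * |(b' - b) v| ≤ |a' v * (b' - b) v| := by
        rw [abs_mul]
        exact mul_le_mul_of_nonneg_right ((ha' v).trans (le_abs_self _)) (abs_nonneg _)
      linarith
    have h2 := pow_le_pow_left₀ (by positivity) h1 2
    rw [mul_pow, mul_pow, mul_pow, sq_abs, Real.sq_sqrt (by positivity)] at h2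
    have h3 : (c ^ 2 * q) * (q * (b' - b) v ^ 2)
        ≤ (c ^ 2 * q) * (K * ((1 + 2 * s / c) ^ 2 / c ^ 2)) := by
      calc _ = c ^ 2 * q ^ 2 * (b' - b) v ^ 2 := by ring
        _ ≤ (1 + 2 * s / c) ^ 2 * (K * q) := h2
        _ = _ := by field_simp
    exact le_of_mul_le_mul_left h3 (by positivity)
  have hzb := abs_le_of_gram_le hs hn hc hwc hw1 hz' (by positivity)
  set R : Fin n → ℝ := fun u => score X b u - gram w (b' - b) u with hRdef
  -- Pairing GΔ = D - R with column v of G⁻¹, by symmetry of G, isolates Δ_v. The two D terms are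
  -- moved to the left and only the remainder R stays.
  have hmain : √a * (b' - b) v - score X b v / √a - √a * ∑ u, z u * score X b u
      = -(√a * (R v / a + ∑ u, z u * R u)) := by
    have h1 : (b' - b) v = ∑ u, (b' - b) u * (Pi.single v 1 : Fin n → ℝ) u := by
      simp [Pi.single_apply]
    have h2 : (b' - b) v = a⁻¹ * gram w (b' - b) v + ∑ u, z u * gram w (b' - b) u := by
      rw [h1, ← hz, sum_mul_gram_comm, ← ha]
      simp only [Pi.add_apply, add_mul, Finset.sum_add_distrib]
      congr 1
      rw [Finset.sum_eq_single v]
      · rw [Pi.single_eq_same]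
      · intro u _ hu
        rw [Pi.single_eq_of_ne hu, zero_mul]
      · simp
    have h3 : score X b v / √a = √a * (score X b v / a) := by
      have : a = √a * √a := (Real.mul_self_sqrt ha0.le).symm
      have h4 := Real.sqrt_pos.2 ha0
      nth_rewrite 3 [this]
      field_simp
    rw [h3, h2]
    simp only [hRdef, mul_sub, Finset.sum_sub_distrib, sub_div]
    ring
  rw [hmain, abs_neg, abs_mul, abs_of_nonneg (Real.sqrt_nonneg a)]
  have hRv : |R v / a| ≤ K / q * (s * ((1 + 2 * s / c) ^ 2 / c ^ 2 + 4 * s / c ^ 2) / c) := by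
    rw [abs_div, abs_of_pos ha0]
    calc |R v| / a ≤ (s * (K * ((1 + 2 * s / c) ^ 2 / c ^ 2) + 4 * K * s / c ^ 2)) / (c * q) := by
          refine div_le_div₀ (by positivity) ?_ (by positivity) hca
          exact (hR v).trans (by gcongr)
      _ = _ := by field_simp
  -- Here the sup bound |z_u| = O(1/(nq)) is paired with the ℓ¹ bound ∑ |R_u| = O(qΨ) = O(Kn), so no
  -- coordinatewise control of Δ is needed away from v.
  have hzR : |∑ u, z u * R u| ≤ K / q * ((1 + 2 * s / c) * s * (s * (1 + s)) * 4 / c ^ 4) := by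
    calc |∑ u, z u * R u| ≤ ∑ u, |z u| * |R u| := by
          refine (Finset.abs_sum_le_sum_abs _ _).trans (le_of_eq ?_)
          exact Finset.sum_congr rfl fun u _ => abs_mul _ _
      _ ≤ ∑ u, ((1 + 2 * s / c) * (s / (c * n)) / (c * q))
            * (s * (q * (b' - b) u ^ 2 + m * Ψ)) := by
          refine Finset.sum_le_sum fun u _ => ?_
          exact mul_le_mul (hzb u) (hR u) (abs_nonneg _) (by positivity)
      _ = ((1 + 2 * s / c) * (s / (c * n)) / (c * q)) * (s * (q * Ψ + (m * n) * Ψ)) := by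
          rw [← Finset.mul_sum, ← Finset.mul_sum, Finset.sum_add_distrib, ← Finset.mul_sum,
            Finset.sum_const, Finset.card_univ, Fintype.card_fin, nsmul_eq_mul]
          ring
      _ ≤ ((1 + 2 * s / c) * (s / (c * n)) / (c * q)) * (s * (q * Ψ + (s * q) * Ψ)) := by gcongr
      _ = ((1 + 2 * s / c) * (s / (c * n)) / (c * q)) * (s * (1 + s)) * (q * Ψ) := by ring
      _ ≤ ((1 + 2 * s / c) * (s / (c * n)) / (c * q)) * (s * (1 + s)) * (4 * K * n / c ^ 2) := by
          gcongr
      _ = _ := by field_simp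
  have hsum : |R v / a + ∑ u, z u * R u| ≤ K / q * linConst s c := by
    refine (abs_add_le _ _).trans ((add_le_add hRv hzR).trans (le_of_eq ?_))
    rw [linConst]
    ring
  have hC : 0 ≤ linConst s c := by unfold linConst; positivity
  calc √a * |R v / a + ∑ u, z u * R u| ≤ √q * (K / q * linConst s c) :=
        mul_le_mul (Real.sqrt_le_sqrt haq) hsum (abs_nonneg _) (Real.sqrt_nonneg _)
    _ = linConst s c * K / √q := by
        have h1 := Real.sqrt_pos.2 hq
        have h2 : q = √q * √q := (Real.mul_self_sqrt hq.le).symm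
        rw [eq_div_iff h1.ne']
        calc √q * (K / q * linConst s c) * √q = (√q * √q) / q * (linConst s c * K) := by ring
          _ = _ := by rw [← h2, div_self hq.ne', one_mul]

end Deterministic

/-! ### Moments and concentration of linear statistics of the edges. -/

section LinearStatistics

variable {n r : ℕ}

/-- The centred indicator of an edge. -/
noncomputable def edgeNoise (B : Params n r) (e : HyperEdge n r) (x : Bool) : ℝ :=
  (if x = true then 1 else 0) - edgeProb B e

/-- The edge observations of one layer. -/
def layerObs (H : LayeredHypergraph n r) (s : Layer r) (e : SEdge n s.1) : ℝ :=
  if H ⟨s, e⟩ = true then 1 else 0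

/-- The linear statistic of the centred edge indicators with coefficients given by edge sums. -/
noncomputable def linStat (B y : Params n r) (H : LayeredHypergraph n r) : ℝ :=
  ∑ e : HyperEdge n r, edgeSum (y e.1) e.2 * edgeNoise B e (H e)

/-- This is the dictionary between sums of independent edge terms, used for variances and
characteristic functions, and combinations of centred degrees. -/
theorem linStat_eq (B y : Params n r) (H : LayeredHypergraph n r) :
    linStat B y H = ∑ s, ∑ u, y s u * score (layerObs H s) (B s) u := by
  rw [linStat, Fintype.sum_sigma]
  refine Finset.sum_congr rfl fun s _ => ?_
  simp only [score]
  rw [← sum_mul_edgeSum]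
  exact Finset.sum_congr rfl fun e _ => mul_comm _ _

theorem integrable_layeredBeta {E : Type*} [NormedAddCommGroup E] (B : Params n r)
    (f : LayeredHypergraph n r → E) : Integrable f (layeredBeta B) :=
  Integrable.of_finite

theorem variance_edgeNoise (B : Params n r) (e : HyperEdge n r) (a : ℝ) :
    Var[fun x => a * edgeNoise B e x;
      bernoulliMeasure true false ⟨edgeProb B e, edgeProb_mem B e⟩]
      = a ^ 2 * (edgeProb B e * (1 - edgeProb B e)) := by
  rw [variance_eq_integral (measurable_of_finite _).aemeasurable, integral_bernoulliMeasure,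
    integral_bernoulliMeasure]
  simp [edgeNoise]
  ring

/-- The variance of a linear statistic, layer by layer. -/
noncomputable def statVar (B y : Params n r) : ℝ :=
  ∑ s : Layer r, ∑ u, y s u * gram (s := s.1) (edgeVar (B s)) (y s) u

theorem statVar_eq (B y : Params n r) :
    statVar B y = ∑ e : HyperEdge n r,
      edgeSum (y e.1) e.2 ^ 2 * (edgeProb B e * (1 - edgeProb B e)) := by
  rw [statVar, Fintype.sum_sigma]
  refine Finset.sum_congr rfl fun s _ => ?_
  rw [sum_mul_gram]
  refine Finset.sum_congr rfl fun e _ => ?_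
  have : edgeVar (B s) e = edgeProb B ⟨s, e⟩ * (1 - edgeProb B ⟨s, e⟩) := rfl
  rw [this]
  ring

theorem variance_linStat (B y : Params n r) :
    Var[linStat B y; layeredBeta B] = statVar B y := by
  have h := variance_sum_pi
    (μ := fun e : HyperEdge n r => bernoulliMeasure true false ⟨edgeProb B e, edgeProb_mem B e⟩)
    (X := fun e x => edgeSum (y e.1) e.2 * edgeNoise B e x) (fun e => MemLp.of_discrete)
  simp_rw [variance_edgeNoise] at h
  rw [statVar_eq, ← h]
  congr 1
  funext H
  simp [linStat, Finset.sum_apply]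

theorem integral_edgeNoise (B : Params n r) (e : HyperEdge n r) :
    ∫ H, edgeNoise B e (H e) ∂layeredBeta B = 0 := by
  have hmp := measurePreserving_eval
    (fun e : HyperEdge n r => bernoulliMeasure true false ⟨edgeProb B e, edgeProb_mem B e⟩) e
  have h := integral_map (μ := layeredBeta B) (φ := Function.eval e) (f := edgeNoise B e)
    (measurable_pi_apply e).aemeasurable (measurable_of_finite _).aestronglyMeasurable
  have h' := hmp.map_eq
  rw [layeredBeta, h', integral_bernoulliMeasure] at h
  rw [layeredBeta]
  refine h.symm.trans ?_
  simp [edgeNoise]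
  ring

theorem integral_linStat (B y : Params n r) : ∫ H, linStat B y H ∂layeredBeta B = 0 := by
  simp only [linStat]
  rw [integral_finsetSum _ fun e _ => integrable_layeredBeta B _]
  refine Finset.sum_eq_zero fun e _ => ?_
  rw [integral_const_mul, integral_edgeNoise, mul_zero]

theorem integral_linStat_sq (B y : Params n r) :
    ∫ H, linStat B y H ^ 2 ∂layeredBeta B = statVar B y := by
  rw [← variance_linStat, variance_of_integral_eq_zero (measurable_of_finite _).aemeasurable
    (integral_linStat B y)]

theorem statVar_single (B : Params n r) (s : Layer r) (x : Fin n → ℝ) :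
    statVar B (Pi.single s x) = ∑ u, x u * gram (s := s.1) (edgeVar (B s)) x u := by
  rw [statVar, Finset.sum_eq_single s]
  · rw [Pi.single_eq_same]
  · intro s' _ hs'
    rw [Pi.single_eq_of_ne hs']
    simp
  · simp

theorem linStat_single (B : Params n r) (s : Layer r) (x : Fin n → ℝ)
    (H : LayeredHypergraph n r) :
    linStat B (Pi.single s x) H = ∑ u, x u * score (layerObs H s) (B s) u := by
  rw [linStat_eq, Finset.sum_eq_single s]
  · rw [Pi.single_eq_same]
  · intro s' _ hs'
    rw [Pi.single_eq_of_ne hs']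
    simp
  · simp

theorem gram_single_self {s : ℕ} (w : SEdge n s → ℝ) (v : Fin n) (a : ℝ) :
    gram w (Pi.single v a) v = vertexSum w v * a := by
  simp only [gram, vertexSum, Finset.sum_mul]
  refine Finset.sum_congr rfl fun e he => ?_
  rw [edgeSum_single, if_pos (Finset.mem_filter.1 he).2]

theorem integral_score_sq (B : Params n r) (s : Layer r) (v : Fin n) :
    ∫ H, score (layerObs H s) (B s) v ^ 2 ∂layeredBeta B
      = vertexSum (s := s.1) (edgeVar (B s)) v := by
  have h := integral_linStat_sq B (Pi.single s (Pi.single v 1))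
  rw [statVar_single] at h
  simp_rw [linStat_single] at h
  simpa [Pi.single_apply, gram_single_self] using h

theorem score_layerObs (B : Params n r) (s : Layer r) (v : Fin n) (H : LayeredHypergraph n r) :
    score (layerObs H s) (B s) v
      = sDegree s v H - vertexSum (fun e : SEdge n s.1 => logistic (edgeSum (B s) e)) v := by
  rw [score, vertexSum_sub]
  congr 1
  rw [vertexSum, sDegree]
  simp only [layerObs]
  rw [← Finset.sum_filter, Finset.filter_filter]
  simp

/-- The score is the degree minus a constant and has mean zero, so the degree variance is the second
moment of the score, a diagonal entry of the Gram matrix. -/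
theorem sigma_eq (B : Params n r) (s : Layer r) (v : Fin n) :
    sigma B s v = √(vertexSum (s := s.1) (edgeVar (B s)) v) := by
  rw [sigma, ← integral_score_sq]
  congr 1
  have h0 : ∫ H, score (layerObs H s) (B s) v ∂layeredBeta B = 0 := by
    have h := integral_linStat B (Pi.single s (Pi.single v 1))
    simp_rw [linStat_single] at h
    simpa [Pi.single_apply] using h
  rw [← variance_of_integral_eq_zero (measurable_of_finite _).aemeasurable h0]
  simp_rw [score_layerObs]
  rw [variance_sub_const (measurable_of_finite _).aestronglyMeasurable]

/-- Markov's inequality for functions on hypergraphs. -/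
theorem measureReal_le_integral_div (B : Params n r) {f : LayeredHypergraph n r → ℝ}
    (hf : ∀ H, 0 ≤ f H) {ε : ℝ} (hε : 0 < ε) :
    (layeredBeta B).real {H | ε ≤ f H} ≤ (∫ H, f H ∂layeredBeta B) / ε := by
  rw [le_div_iff₀ hε, mul_comm]
  exact mul_meas_ge_le_integral_of_nonneg (ae_of_all _ hf) (integrable_layeredBeta B f) ε

theorem iIndepFun_edgeNoise (B : Params n r) :
    iIndepFun (fun e H => edgeNoise B e (H e)) (layeredBeta B) :=
  iIndepFun_pi fun e => (measurable_of_finite (edgeNoise B e)).aemeasurable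

theorem hasSubgaussianMGF_edgeNoise (B : Params n r) (e : HyperEdge n r) :
    HasSubgaussianMGF (fun H => edgeNoise B e (H e)) (1 / 4) (layeredBeta B) := by
  have h := hasSubgaussianMGF_of_mem_Icc_of_integral_eq_zero (μ := layeredBeta B)
    (X := fun H => edgeNoise B e (H e)) (a := -edgeProb B e) (b := 1 - edgeProb B e)
    (measurable_of_finite _).aemeasurable (ae_of_all _ fun H => by
      simp only [edgeNoise]
      split_ifs <;> simp) (integral_edgeNoise B e)
  convert! h using 1
  simp
  norm_num

/-- Hoeffding's inequality for the degrees. -/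
theorem measureReal_score_ge_le (B : Params n r) (s : Layer r) (u : Fin n) {ε : ℝ} (hε : 0 ≤ ε) :
    (layeredBeta B).real {H | ε * thru n s.1 ≤ |score (layerObs H s) (B s) u|}
      ≤ 2 * Real.exp (-(2 * ε ^ 2 * thru n s.1)) := by
  have hs : 2 ≤ s.1 := (Finset.mem_Icc.1 s.2).1
  have hinj : Function.Injective (fun e : SEdge n s.1 => (⟨s, e⟩ : HyperEdge n r)) :=
    fun a b h => by simpa using h
  have hind := (iIndepFun_edgeNoise B).precomp hinj
  have hsub := HasSubgaussianMGF.sum_of_iIndepFun hind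
    (s := Finset.univ.filter fun e : SEdge n s.1 => u ∈ e.1) (c := fun _ => 1 / 4)
    (fun e _ => hasSubgaussianMGF_edgeNoise B ⟨s, e⟩)
  have hq0 : 0 ≤ ε * thru n s.1 := mul_nonneg hε thru_nonneg
  have hc : ((∑ _e ∈ Finset.univ.filter fun e : SEdge n s.1 => u ∈ e.1, (1 / 4 : NNReal) : NNReal)
      : ℝ) = thru n s.1 / 4 := by
    rw [Finset.sum_const, nsmul_eq_mul]
    push_cast
    rw [card_edges_mem (by omega)]
    ring
  have hexp : -(ε * thru n s.1) ^ 2 / (2 * (thru n s.1 / 4)) = -(2 * ε ^ 2 * thru n s.1) := by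
    -- If there are no edges through a vertex, the division by zero takes the value 0 and both sides
    -- vanish.
    rcases eq_or_ne (thru n s.1) 0 with h | h
    · simp [h]
    · field_simp
      ring
  have h1 := hsub.measure_ge_le hq0
  have h2 := hsub.neg.measure_ge_le hq0
  rw [hc, hexp] at h1 h2
  have hset : {H | ε * thru n s.1 ≤ |score (layerObs H s) (B s) u|}
      ⊆ {H : LayeredHypergraph n r | ε * thru n s.1
          ≤ ∑ e ∈ Finset.univ.filter fun e : SEdge n s.1 => u ∈ e.1,
            edgeNoise B ⟨s, e⟩ (H ⟨s, e⟩)}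
        ∪ {H | ε * thru n s.1 ≤ (-fun H : LayeredHypergraph n r =>
            ∑ e ∈ Finset.univ.filter fun e : SEdge n s.1 => u ∈ e.1,
              edgeNoise B ⟨s, e⟩ (H ⟨s, e⟩)) H} := by
    intro H hH
    have h : ε * thru n s.1 ≤ |score (layerObs H s) (B s) u| := hH
    exact le_abs.1 h
  refine (measureReal_mono hset).trans ((measureReal_union_le _ _).trans ?_)
  linarith

end LinearStatistics

/-! ### A quantitative central limit theorem through characteristic functions. -/

section CharFun

theorem norm_exp_I_taylor_le {x : ℝ} (hx : |x| ≤ 1) :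
    ‖Complex.exp (x * Complex.I) - (1 + x * Complex.I - x ^ 2 / 2)‖ ≤ 3 * |x| ^ 3 := by
  have h := Complex.norm_exp_sub_sum_le_norm_mul_exp (x * Complex.I) 3
  have hn : ‖(x * Complex.I : ℂ)‖ = |x| := by simp
  rw [hn] at h
  have h1 : Complex.exp (x * Complex.I) - (1 + x * Complex.I - x ^ 2 / 2)
      = Complex.exp (x * Complex.I)
        - ∑ m ∈ Finset.range 3, (x * Complex.I) ^ m / (m.factorial : ℂ) := by
    simp [Finset.sum_range_succ, mul_pow, Nat.factorial]
    ring
  rw [h1]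
  refine h.trans ?_
  rw [mul_comm]
  refine mul_le_mul_of_nonneg_right ?_ (by positivity)
  calc Real.exp |x| ≤ Real.exp 1 := Real.exp_le_exp.2 hx
    _ ≤ 3 := by linarith [Real.exp_one_lt_d9]

/-- The characteristic function of a centred Bernoulli variable. -/
theorem norm_bernoulli_charFun_sub_le {p a : ℝ} (hp : p ∈ Set.Icc (0 : ℝ) 1) (ha : |a| ≤ 1) :
    ‖((p * Complex.exp ((a * (1 - p) : ℝ) * Complex.I)
        + (1 - p) * Complex.exp ((-(a * p) : ℝ) * Complex.I) : ℂ))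
      - (Real.exp (-(a ^ 2 * (p * (1 - p))) / 2) : ℝ)‖ ≤ 4 * |a| ^ 3 := by
  obtain ⟨hp0, hp1⟩ := hp
  have hq0 : 0 ≤ 1 - p := by linarith
  have hx1 : |a * (1 - p)| ≤ |a| := by
    rw [abs_mul, abs_of_nonneg hq0]
    exact mul_le_of_le_one_right (abs_nonneg _) (by linarith)
  have hx2 : |-(a * p)| ≤ |a| := by
    rw [abs_neg, abs_mul, abs_of_nonneg hp0]
    exact mul_le_of_le_one_right (abs_nonneg _) hp1
  have h1 := (norm_exp_I_taylor_le (hx1.trans ha)).trans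
    (mul_le_mul_of_nonneg_left (pow_le_pow_left₀ (abs_nonneg _) hx1 3) (by norm_num))
  have h2 := (norm_exp_I_taylor_le (hx2.trans ha)).trans
    (mul_le_mul_of_nonneg_left (pow_le_pow_left₀ (abs_nonneg _) hx2 3) (by norm_num))
  set y := a ^ 2 * (p * (1 - p)) with hy
  have hw : p * (1 - p) ≤ 1 := by nlinarith
  have hw0 : 0 ≤ p * (1 - p) := mul_nonneg hp0 hq0
  have ha2 : a ^ 2 ≤ 1 := by rw [← sq_abs]; exact pow_le_one₀ (abs_nonneg _) ha
  have hya : y ≤ a ^ 2 := mul_le_of_le_one_right (sq_nonneg _) hw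
  have hy0 : 0 ≤ y := mul_nonneg (sq_nonneg _) hw0
  have h3 : |Real.exp (-y / 2) - (1 - y / 2)| ≤ |a| ^ 3 := by
    have h := Real.norm_exp_sub_one_sub_id_le (x := -y / 2) (by
      rw [Real.norm_eq_abs, abs_le]; constructor <;> linarith)
    rw [Real.norm_eq_abs, Real.norm_eq_abs, sq_abs] at h
    have h4 : Real.exp (-y / 2) - (1 - y / 2) = Real.exp (-y / 2) - 1 - -y / 2 := by ring
    rw [h4]
    refine h.trans ?_
    have h5 : a ^ 2 * a ^ 2 ≤ |a| ^ 3 := by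
      calc a ^ 2 * a ^ 2 = |a| ^ 3 * |a| := by rw [← sq_abs]; ring
        _ ≤ |a| ^ 3 * 1 := mul_le_mul_of_nonneg_left ha (by positivity)
        _ = |a| ^ 3 := mul_one _
    nlinarith
  -- In the average of the two second-order expansions the linear terms cancel and the quadratic
  -- ones add up to a²p(1 - p) = y. The remainders contribute 3|a|³, and replacing 1 - y/2 by the
  -- exponential costs another |a|³.
  have hdecomp : ((p * Complex.exp ((a * (1 - p) : ℝ) * Complex.I)
        + (1 - p) * Complex.exp ((-(a * p) : ℝ) * Complex.I) : ℂ))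
      - (Real.exp (-y / 2) : ℝ)
      = p * (Complex.exp ((a * (1 - p) : ℝ) * Complex.I)
            - (1 + (a * (1 - p) : ℝ) * Complex.I - (a * (1 - p) : ℝ) ^ 2 / 2))
        + (1 - p : ℝ) * (Complex.exp ((-(a * p) : ℝ) * Complex.I)
            - (1 + (-(a * p) : ℝ) * Complex.I - (-(a * p) : ℝ) ^ 2 / 2))
        - ((Real.exp (-y / 2) - (1 - y / 2) : ℝ) : ℂ) := by
    rw [hy]
    push_cast
    ring
  rw [hdecomp]
  refine (norm_sub_le _ _).trans ?_
  refine (add_le_add (norm_add_le _ _) le_rfl).trans ?_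
  rw [norm_mul, norm_mul, Complex.norm_real, Complex.norm_real, Complex.norm_real,
    Real.norm_eq_abs, Real.norm_eq_abs, Real.norm_eq_abs, abs_of_nonneg hp0, abs_of_nonneg hq0]
  nlinarith [mul_le_mul_of_nonneg_left h1 hp0, mul_le_mul_of_nonneg_left h2 hq0]

/-- Telescoping: the factors are replaced one at a time, all others having norm at most 1. -/
theorem norm_prod_sub_prod_le {ι : Type*} (s : Finset ι) {f g : ι → ℂ}
    (hf : ∀ i, ‖f i‖ ≤ 1) (hg : ∀ i, ‖g i‖ ≤ 1) :
    ‖∏ i ∈ s, f i - ∏ i ∈ s, g i‖ ≤ ∑ i ∈ s, ‖f i - g i‖ := by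
  classical
  induction s using Finset.induction_on with
  | empty => simp
  | insert i s hi ih =>
    rw [Finset.prod_insert hi, Finset.prod_insert hi, Finset.sum_insert hi]
    have h : f i * ∏ j ∈ s, f j - g i * ∏ j ∈ s, g j
        = (f i - g i) * ∏ j ∈ s, f j + g i * (∏ j ∈ s, f j - ∏ j ∈ s, g j) := by ring
    rw [h]
    refine (norm_add_le _ _).trans (add_le_add ?_ ?_)
    · rw [norm_mul]
      refine mul_le_of_le_one_right (norm_nonneg _) ?_
      rw [norm_prod]
      exact Finset.prod_le_one (fun j _ => norm_nonneg _) fun j _ => hf j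
    · rw [norm_mul]
      exact (mul_le_of_le_one_left (norm_nonneg _) (hg i)).trans ih

variable {n r : ℕ}

/-- Quantitative central limit theorem for linear statistics of the edge indicators. -/
theorem norm_charFun_linStat_sub_le (B y : Params n r) {η c : ℝ} (hη1 : η ≤ 1)
    (hη : ∀ e : HyperEdge n r, |edgeSum (y e.1) e.2| ≤ η) (hc : 0 < c)
    (hcB : ∀ e : HyperEdge n r, c ≤ edgeProb B e * (1 - edgeProb B e)) :
    ‖∫ H, Complex.exp (linStat B y H * Complex.I) ∂layeredBeta B
      - (Real.exp (-statVar B y / 2) : ℝ)‖ ≤ 4 * η / c * statVar B y := by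
  have h1 : ∫ H, Complex.exp (linStat B y H * Complex.I) ∂layeredBeta B
      = ∏ e : HyperEdge n r, ((edgeProb B e : ℂ) * Complex.exp
          ((edgeSum (y e.1) e.2 * (1 - edgeProb B e) : ℝ) * Complex.I)
        + (1 - edgeProb B e) * Complex.exp
          ((-(edgeSum (y e.1) e.2 * edgeProb B e) : ℝ) * Complex.I)) := by
    have h := integral_fintype_prod_eq_prod (𝕜 := ℂ)
      (μ := fun e : HyperEdge n r => bernoulliMeasure true false ⟨edgeProb B e, edgeProb_mem B e⟩)
      (fun e x => Complex.exp ((edgeSum (y e.1) e.2 * edgeNoise B e x : ℝ) * Complex.I))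
    simp_rw [← Complex.exp_sum, integral_bernoulliMeasure] at h
    rw [layeredBeta]
    convert! h using 1
    · congr 1
      funext H
      rw [linStat]
      push_cast
      rw [Finset.sum_mul]
    · refine Finset.prod_congr rfl fun e _ => ?_
      simp [edgeNoise]
  have h2 : ((Real.exp (-statVar B y / 2) : ℝ) : ℂ)
      = ∏ e : HyperEdge n r, ((Real.exp (-(edgeSum (y e.1) e.2 ^ 2
          * (edgeProb B e * (1 - edgeProb B e))) / 2) : ℝ) : ℂ) := by
    rw [← Complex.ofReal_prod, ← Real.exp_sum, statVar_eq, ← Finset.sum_div,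
      ← Finset.sum_neg_distrib]
  rw [h1, h2]
  refine (norm_prod_sub_prod_le _ ?_ ?_).trans ?_
  · intro e
    obtain ⟨hp0, hp1⟩ := edgeProb_mem B e
    refine (norm_add_le _ _).trans ?_
    have h3 : (1 - edgeProb B e : ℂ) = ((1 - edgeProb B e : ℝ) : ℂ) := by push_cast; rfl
    rw [h3, norm_mul, norm_mul, Complex.norm_exp_ofReal_mul_I, Complex.norm_exp_ofReal_mul_I,
      Complex.norm_real, Complex.norm_real, Real.norm_eq_abs, Real.norm_eq_abs,
      abs_of_nonneg hp0, abs_of_nonneg (sub_nonneg.2 hp1)]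
    linarith
  · intro e
    obtain ⟨hp0, hp1⟩ := edgeProb_mem B e
    rw [Complex.norm_real, Real.norm_eq_abs, abs_of_pos (Real.exp_pos _), Real.exp_le_one_iff]
    have := mul_nonneg (sq_nonneg (edgeSum (y e.1) e.2)) (mul_nonneg hp0 (sub_nonneg.2 hp1))
    linarith
  · rw [statVar_eq, Finset.mul_sum]
    refine Finset.sum_le_sum fun e _ => ?_
    refine (norm_bernoulli_charFun_sub_le (edgeProb_mem B e) ((hη e).trans hη1)).trans ?_
    -- A Lyapunov-type bound: one factor of the cube is at most η, and the remaining square is at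
    -- most 1/c times the variance of the edge term.
    have h3 : |edgeSum (y e.1) e.2| ^ 3 ≤ η * edgeSum (y e.1) e.2 ^ 2 := by
      rw [pow_succ', ← sq_abs (edgeSum _ _)]
      exact mul_le_mul_of_nonneg_right (hη e) (sq_nonneg _)
    have hη0 : 0 ≤ η := (abs_nonneg _).trans (hη e)
    calc 4 * |edgeSum (y e.1) e.2| ^ 3 ≤ 4 * (η * edgeSum (y e.1) e.2 ^ 2) := by linarith
      _ = 4 * η / c * (edgeSum (y e.1) e.2 ^ 2 * c) := by field_simp
      _ ≤ _ := by
          have := hcB e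
          gcongr

end CharFun

/-! ### From the ML estimator to normalized centred degrees, with high probability. -/

section MaximumLikelihood

variable {n r : ℕ}

theorem likelihood_eq (H : LayeredHypergraph n r) (B : Params n r) :
    likelihood H B = Real.exp (∑ s : Layer r, logLik (layerObs H s) (B s)) := by
  have h1 : ∀ e : HyperEdge n r,
      (bernoulliMeasure true false ⟨edgeProb B e, edgeProb_mem B e⟩).real {H e}
        = Real.exp ((if H e = true then 1 else 0) * edgeSum (B e.1) e.2
          - logPartition (edgeSum (B e.1) e.2)) := by
    intro e
    have hp : edgeProb B e = logistic (edgeSum (B e.1) e.2) := rfl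
    have hpos : (0 : ℝ) < 1 + Real.exp (edgeSum (B e.1) e.2) := by positivity
    rw [bernoulliMeasure_real_apply _ (measurableSet_singleton _), Real.exp_sub, logPartition,
      Real.exp_log hpos]
    cases H e
    · simp [hp, one_sub_logistic]
    · simp [hp, logistic]
  rw [likelihood, layeredBeta, measureReal_def, Measure.pi_singleton, ENNReal.toReal_prod]
  simp_rw [← measureReal_def, h1]
  rw [← Real.exp_sum, Fintype.sum_sigma]
  rfl

/-- The log-likelihood is a sum of functions of separate layers; changing one layer at a time gives
the forward direction. -/
theorem isMaxOn_likelihood_iff {H : LayeredHypergraph n r} {B : Params n r} :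
    IsMaxOn (likelihood H) Set.univ B ↔
      ∀ s b, logLik (layerObs H s) b ≤ logLik (layerObs H s) (B s) := by
  classical
  simp only [isMaxOn_iff, Set.mem_univ, forall_true_left, likelihood_eq, Real.exp_le_exp]
  constructor
  · intro h s b
    have h1 := h (Function.update B s b)
    rw [← Finset.add_sum_erase _ _ (Finset.mem_univ s),
      ← Finset.add_sum_erase _ (fun s => logLik (layerObs H s) (B s)) (Finset.mem_univ s)] at h1
    have h2 : ∑ s' ∈ Finset.univ.erase s, logLik (layerObs H s') (Function.update B s b s')
        = ∑ s' ∈ Finset.univ.erase s, logLik (layerObs H s') (B s') :=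
      Finset.sum_congr rfl fun s' hs' => by
        rw [Function.update_of_ne (Finset.ne_of_mem_erase hs')]
    rw [h2, Function.update_self] at h1
    linarith
  · intro h B'
    exact Finset.sum_le_sum fun s _ => h s _

/-- An ML estimator is constrained only where the full likelihood has a maximizer, so maximizers are
required in all layers even to learn about a single one. -/
theorem IsMLE.logLik_le {Bhat : LayeredHypergraph n r → Params n r} (hB : IsMLE Bhat)
    {H : LayeredHypergraph n r}
    (h : ∀ s, ∃ b', ∀ b, logLik (layerObs H s) b ≤ logLik (layerObs H s) b') (s : Layer r)
    (b : Fin n → ℝ) : logLik (layerObs H s) b ≤ logLik (layerObs H s) (Bhat H s) := by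
  choose b' hb' using h
  exact isMaxOn_likelihood_iff.1 (hB H ⟨b', isMaxOn_likelihood_iff.2 hb'⟩) s b

/-- The hypergraphs whose centred degrees in layer `s` are not exceptionally large. -/
def goodSet (M K : ℝ) (B : Params n r) (s : Layer r) : Set (LayeredHypergraph n r) :=
  {H | ∑ u, score (layerObs H s) (B s) u ^ 2 ≤ K * n * thru n s.1 ∧
    ∀ u, |score (layerObs H s) (B s) u| ≤ curvature (s.1 * (M + 1)) * thru n s.1 / 2}

theorem two_le_layer (s : Layer r) : 2 ≤ s.1 := (Finset.mem_Icc.1 s.2).1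

theorem layer_le (s : Layer r) : s.1 ≤ r := (Finset.mem_Icc.1 s.2).2

/-- Markov's inequality bounds the sum of squares, whose mean is at most `n * thru`; Hoeffding with
a union bound over the vertices handles the maximum. -/
theorem measureReal_compl_goodSet_le {M K : ℝ} (hK : 0 < K) (hn : 2 * r ≤ n) (B : Params n r)
    (s : Layer r) :
    (layeredBeta B).real (goodSet M K B s)ᶜ
      ≤ 1 / K + n * (2 * Real.exp (-(2 * (curvature (s.1 * (M + 1)) / 2) ^ 2 * thru n s.1))) := by
  have hs := two_le_layer s
  have hsr := layer_le s
  have hq := thru_pos (n := n) hs (by omega)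
  have hn0 : (0 : ℝ) < n := by exact_mod_cast (by omega : 0 < n)
  set c := curvature (s.1 * (M + 1)) with hcdef
  have hc : 0 < c := curvature_pos _
  have hsub : (goodSet M K B s)ᶜ
      ⊆ {H | K * n * thru n s.1 ≤ ∑ u, score (layerObs H s) (B s) u ^ 2}
        ∪ ⋃ u ∈ (Finset.univ : Finset (Fin n)),
          {H | c / 2 * thru n s.1 ≤ |score (layerObs H s) (B s) u|} := by
    intro H hH
    simp only [goodSet, Set.mem_compl_iff, Set.mem_ofPred_eq, not_and_or, not_forall, not_le] at hH
    rcases hH with hH | ⟨u, hu⟩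
    · exact Or.inl hH.le
    · refine Or.inr (Set.mem_biUnion (Finset.mem_coe.2 (Finset.mem_univ u)) ?_)
      refine le_trans (le_of_eq ?_) hu.le
      ring
  refine (measureReal_mono hsub).trans ((measureReal_union_le _ _).trans (add_le_add ?_ ?_))
  · refine (measureReal_le_integral_div B (fun H => Finset.sum_nonneg fun u _ => sq_nonneg _)
      (by positivity)).trans ?_
    rw [integral_finsetSum _ fun u _ => integrable_layeredBeta B _]
    simp_rw [integral_score_sq]
    rw [div_le_div_iff₀ (by positivity) hK]
    have h1 : ∑ u, vertexSum (s := s.1) (edgeVar (B s)) u ≤ n * thru n s.1 := by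
      refine (Finset.sum_le_sum fun u _ => vertexSum_le (by omega) (edgeVar_le_one (B s)) u).trans
        (le_of_eq ?_)
      simp
    nlinarith
  · refine (measureReal_biUnion_finset_le _ _).trans ?_
    refine (Finset.sum_le_sum fun u _ =>
      measureReal_score_ge_le B s u (by positivity : 0 ≤ c / 2)).trans (le_of_eq ?_)
    simp

/-- Existence of a nearby maximizer in each layer forces the estimator to be a maximizer, and
uniqueness identifies the two. -/
theorem abs_estimate_sub_le_one {M K : ℝ} (hK : 0 < K) (hn : 2 * r ≤ n) {B : Params n r}
    (hB : ∀ s v, |B s v| ≤ M) {Bhat : LayeredHypergraph n r → Params n r} (hMLE : IsMLE Bhat)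
    (hlarge : ∀ s : Layer r, 2 * s.1 / curvature (s.1 * (M + 1)) * √(K * thru n s.1)
      < curvature (s.1 * (M + 1)) * thru n s.1 / 2)
    {H : LayeredHypergraph n r} (hH : ∀ s, H ∈ goodSet M K B s) (s : Layer r) :
    (∀ u, |(Bhat H s - B s) u| ≤ 1) ∧ ∀ u, score (layerObs H s) (Bhat H s) u = 0 := by
  have hs := two_le_layer s
  have hsr := layer_le s
  have hex := fun s : Layer r => exists_isMax_near (two_le_layer s)
    (le_trans (Nat.mul_le_mul_left 2 (layer_le s)) hn) (hB s) hK.le (hH s).1 (hH s).2 (hlarge s)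
  have hmax := hMLE.logLik_le (fun s => (hex s).imp fun b' h => h.1) s
  have hzero := score_eq_zero_of_isMax hmax
  obtain ⟨b', hb', hbb⟩ := hex s
  have heq := eq_of_score_eq_zero hs (by omega) hzero (score_eq_zero_of_isMax hb')
  exact ⟨fun u => by rw [heq]; exact hbb u, hzero⟩

theorem tendsto_mul_exp_neg_mul {κ : ℝ} (hκ : 0 < κ) :
    Tendsto (fun n : ℕ => (n : ℝ) * Real.exp (-(κ * n))) atTop (nhds 0) := by
  have h1 : Tendsto (fun n : ℕ => κ * (n : ℝ)) atTop atTop :=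
    tendsto_natCast_atTop_atTop.const_mul_atTop hκ
  have h2 := ((Real.tendsto_pow_mul_exp_neg_atTop_nhds_zero 1).comp h1).const_mul κ⁻¹
  rw [mul_zero] at h2
  refine h2.congr fun n => ?_
  simp only [Function.comp_apply, pow_one]
  field_simp

theorem eventually_le_thru (s : Layer r) (A : ℝ) : ∀ᶠ n : ℕ in atTop, A ≤ thru n s.1 := by
  have hs := two_le_layer s
  have hs0 : (0 : ℝ) < s.1 := by exact_mod_cast (by omega : 0 < s.1)
  filter_upwards [eventually_ge_atTop (2 * s.1),
    (tendsto_natCast_atTop_atTop (R := ℝ)).eventually_ge_atTop (A * s.1)] with n hn hA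
  exact ((le_div_iff₀ hs0).2 hA).trans (div_le_thru hs hn)

theorem eventually_sqrt_lt (s : Layer r) {c K : ℝ} (hc : 0 < c) (hK : 0 < K) :
    ∀ᶠ n : ℕ in atTop, 2 * s.1 / c * √(K * thru n s.1) < c * thru n s.1 / 2 := by
  filter_upwards [eventually_le_thru s ((4 * s.1 / c ^ 2) ^ 2 * K + 1)] with n hn
  have hq : 0 < thru n s.1 := lt_of_lt_of_le (by positivity) hn
  have h1 : √(K * thru n s.1) < c ^ 2 / (4 * s.1) * thru n s.1 := by
    have hs0 : (0 : ℝ) < s.1 := by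
      have := two_le_layer s
      exact_mod_cast (by omega : 0 < s.1)
    rw [Real.sqrt_lt' (by positivity)]
    have h2 : K * (4 * s.1 / c ^ 2) ^ 2 < thru n s.1 := by linarith
    calc K * thru n s.1
        = (c ^ 2 / (4 * s.1)) ^ 2 * thru n s.1 * (K * (4 * s.1 / c ^ 2) ^ 2) := by field_simp
      _ < (c ^ 2 / (4 * s.1)) ^ 2 * thru n s.1 * thru n s.1 :=
          mul_lt_mul_of_pos_left h2 (by positivity)
      _ = _ := by ring
  have hs0 : (0 : ℝ) < s.1 := by
    have := two_le_layer s
    exact_mod_cast (by omega : 0 < s.1)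
  calc 2 * s.1 / c * √(K * thru n s.1) < 2 * s.1 / c * (c ^ 2 / (4 * s.1) * thru n s.1) :=
        mul_lt_mul_of_pos_left h1 (by positivity)
    _ = _ := by field_simp; norm_num

/-- The good sets have large probability, uniformly over bounded parameters. -/
theorem eventually_measureReal_compl_goodSet_le (s : Layer r) (M : ℝ) {K : ℝ} (hK : 0 < K) :
    ∀ᶠ n : ℕ in atTop, ∀ B : Params n r,
      (layeredBeta B).real (goodSet M K B s)ᶜ ≤ 2 / K := by
  set c := curvature (s.1 * (M + 1)) with hcdef
  have hc : 0 < c := curvature_pos _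
  have hs := two_le_layer s
  have hsr := layer_le s
  have hs0 : (0 : ℝ) < s.1 := by exact_mod_cast (by omega : 0 < s.1)
  have hκ : 0 < 2 * (c / 2) ^ 2 / s.1 := by positivity
  have ht := (tendsto_mul_exp_neg_mul hκ).const_mul 2
  rw [mul_zero] at ht
  filter_upwards [eventually_ge_atTop (2 * r), ht.eventually_le_const (by positivity : 0 < 1 / K)]
    with n hn hn2 B
  refine (measureReal_compl_goodSet_le hK hn B s).trans ?_
  have h1 : Real.exp (-(2 * (c / 2) ^ 2 * thru n s.1))
      ≤ Real.exp (-(2 * (c / 2) ^ 2 / s.1 * n)) := by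
    rw [Real.exp_le_exp, neg_le_neg_iff]
    calc 2 * (c / 2) ^ 2 / s.1 * n = 2 * (c / 2) ^ 2 * (n / s.1) := by ring
      _ ≤ _ := mul_le_mul_of_nonneg_left (div_le_thru hs (by omega)) (by positivity)
  have h2 : n * (2 * Real.exp (-(2 * (c / 2) ^ 2 * thru n s.1)))
      ≤ 2 * (n * Real.exp (-(2 * (c / 2) ^ 2 / s.1 * n))) := by
    have := mul_le_mul_of_nonneg_left h1 (Nat.cast_nonneg n : (0 : ℝ) ≤ n)
    linarith
  calc _ ≤ 1 / K + 1 / K := by linarith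
    _ = 2 / K := by ring

/-- The linear correction term is negligible. -/
theorem measureReal_correction_ge_le {M ε : ℝ} (hn : 2 * r ≤ n) {B : Params n r}
    (hB : ∀ s v, |B s v| ≤ M) (hε : 0 < ε) (s : Layer r) (v : Fin n) {z : Fin n → ℝ}
    (hz : ∀ u, |gram (s := s.1) (edgeVar (B s)) z u|
      ≤ s.1 / (curvature (s.1 * (M + 1)) * n)) :
    (layeredBeta B).real {H | ε ≤ |√(vertexSum (s := s.1) (edgeVar (B s)) v)
        * ∑ u, z u * score (layerObs H s) (B s) u|}
      ≤ 2 * s.1 ^ 2 / (curvature (s.1 * (M + 1)) ^ 3 * ε ^ 2) / n := by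
  have hs := two_le_layer s
  have hsr := layer_le s
  have hns : 2 * s.1 ≤ n := by omega
  have hwc := curvature_le_edgeVar (s := s.1) (hB s)
  set c := curvature (s.1 * (M + 1)) with hcdef
  have hc : 0 < c := curvature_pos _
  have hq := thru_pos hs hns
  have hn0 : (0 : ℝ) < n := by exact_mod_cast (by omega : 0 < n)
  have hl1 := sum_abs_le_of_gram_le hs hns hc hwc hz (by positivity)
  set a := vertexSum (s := s.1) (edgeVar (B s)) v with hadef
  have ha : a ≤ thru n s.1 := vertexSum_le (by omega) (edgeVar_le_one (B s)) v
  have ha0 : 0 ≤ a := (mul_pos hc hq).le.trans (le_vertexSum (by omega) hwc v)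
  have hset : {H | ε ≤ |√a * ∑ u, z u * score (layerObs H s) (B s) u|}
      = {H | ε ^ 2 ≤ a * linStat B (Pi.single s z) H ^ 2} := by
    ext H
    have h : a * linStat B (Pi.single s z) H ^ 2
        = (√a * ∑ u, z u * score (layerObs H s) (B s) u) ^ 2 := by
      rw [linStat_single, mul_pow, Real.sq_sqrt ha0]
    rw [Set.mem_ofPred_eq, Set.mem_ofPred_eq, h, sq_le_sq, abs_of_pos hε]
  rw [hset]
  refine (measureReal_le_integral_div B (fun H => mul_nonneg ha0 (sq_nonneg _))
    (by positivity)).trans ?_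
  rw [integral_const_mul, integral_linStat_sq, statVar_single]
  have h1 : ∑ u, z u * gram (s := s.1) (edgeVar (B s)) z u
      ≤ (s.1 / (c * n)) * (2 * n * (s.1 / (c * n)) / (c * thru n s.1)) := by
    -- The variance z·Gz is at most ‖Gz‖_∞ ‖z‖₁, of order 1/(nq). The factor `a ≤ thru` then leaves
    -- order 1/n.
    refine le_trans ?_ (mul_le_mul_of_nonneg_left hl1 (by positivity))
    rw [Finset.mul_sum]
    refine Finset.sum_le_sum fun u _ => (le_abs_self _).trans ?_
    rw [abs_mul, mul_comm]
    exact mul_le_mul_of_nonneg_right (hz u) (abs_nonneg _)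
  have h0 : 0 ≤ ∑ u, z u * gram (s := s.1) (edgeVar (B s)) z u :=
    le_trans (by positivity) (le_sum_mul_gram hs hns hc.le hwc z)
  calc a * (∑ u, z u * gram (s := s.1) (edgeVar (B s)) z u) / ε ^ 2
      ≤ thru n s.1 * ((s.1 / (c * n)) * (2 * n * (s.1 / (c * n)) / (c * thru n s.1))) / ε ^ 2 := by
        gcongr
    _ = _ := by field_simp

/-- The normalized estimation error is asymptotically equal to the normalized centred degree. -/
theorem eventually_measureReal_linearization_le (M : ℝ) (s : Layer r) {ε η : ℝ} (hε : 0 < ε)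
    (hη : 0 < η) :
    ∀ᶠ n : ℕ in atTop, ∀ B : Params n r, (∀ s v, |B s v| ≤ M) →
      ∀ Bhat : LayeredHypergraph n r → Params n r, IsMLE Bhat → ∀ v : Fin n,
        (layeredBeta B).real {H | ε ≤ |sigma B s v * (Bhat H s v - B s v)
          - score (layerObs H s) (B s) v / sigma B s v|} ≤ η := by
  -- The budget is 2/K for the complement of the good set in each layer and 1/K for a large centred
  -- degree at `v`; the other η/2 pays for the linear correction.
  obtain ⟨K, hK, hKη⟩ : ∃ K : ℝ, 0 < K ∧ (2 * Fintype.card (Layer r) + 1) / K ≤ η / 2 := by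
    refine ⟨(2 * Fintype.card (Layer r) + 1) / (η / 2), by positivity, le_of_eq ?_⟩
    field_simp
  have hs := two_le_layer s
  have hsr := layer_le s
  set C := linConst s.1 (curvature (s.1 * (M + 1))) with hC
  have hlim : Tendsto (fun n : ℕ => 2 * (s.1 : ℝ) ^ 2
      / (curvature (s.1 * (M + 1)) ^ 3 * (ε / 2) ^ 2) / n) atTop (nhds 0) :=
    tendsto_const_div_atTop_nhds_zero_nat _
  filter_upwards [eventually_ge_atTop (2 * r),
    eventually_all.2 fun s : Layer r => eventually_measureReal_compl_goodSet_le s M hK,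
    eventually_all.2 fun s : Layer r =>
      eventually_sqrt_lt s (curvature_pos (s.1 * (M + 1))) hK,
    hlim.eventually_le_const (by positivity : 0 < η / 2),
    eventually_le_thru s ((C * K / (ε / 2)) ^ 2 + 1)]
    with n hn hgood hlarge hcor hq B hB Bhat hMLE v
  have hns : 2 * s.1 ≤ n := by omega
  have hq0 := thru_pos hs hns
  obtain ⟨z, hz, hz'⟩ := exists_gram_single hs hns (curvature_pos _)
    (curvature_le_edgeVar (s := s.1) (hB s)) (edgeVar_le_one (B s)) v
  set a := vertexSum (s := s.1) (edgeVar (B s)) v with hadef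
  have hsub : {H | ε ≤ |sigma B s v * (Bhat H s v - B s v)
          - score (layerObs H s) (B s) v / sigma B s v|}
      ⊆ (⋃ s' ∈ (Finset.univ : Finset (Layer r)), (goodSet M K B s')ᶜ)
        ∪ ({H | K * thru n s.1 ≤ score (layerObs H s) (B s) v ^ 2}
          ∪ {H | ε / 2 ≤ |√a * ∑ u, z u * score (layerObs H s) (B s) u|}) := by
    intro H hH
    by_contra hcon
    simp only [Set.mem_union, Set.mem_iUnion, Finset.mem_univ, exists_true_left, not_or,
      not_exists, Set.mem_compl_iff, not_not, Set.mem_ofPred_eq, not_le] at hcon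
    obtain ⟨hg, hDv, hcorr⟩ := hcon
    obtain ⟨hbb, hzero⟩ := abs_estimate_sub_le_one hK hn hB hMLE hlarge hg s
    have hlin := abs_linearization_le hs hns (hB s) hK.le (hg s).1 hbb hzero hDv.le rfl hadef hz hz'
    have herr : C * K / √(thru n s.1) < ε / 2 := by
      rw [div_lt_iff₀ (Real.sqrt_pos.2 hq0), ← div_lt_iff₀' (by positivity)]
      exact Real.lt_sqrt_of_sq_lt (by linarith)
    rw [Set.mem_ofPred_eq, sigma_eq, ← hadef] at hH
    have htri := abs_add_le
      (√a * (Bhat H s - B s) v - score (layerObs H s) (B s) v / √a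
        - √a * ∑ u, z u * score (layerObs H s) (B s) u)
      (√a * ∑ u, z u * score (layerObs H s) (B s) u)
    rw [sub_add_cancel] at htri
    simp only [Pi.sub_apply] at htri hlin
    linarith
  refine (measureReal_mono hsub).trans ((measureReal_union_le _ _).trans ?_)
  have h1 : (layeredBeta B).real (⋃ s' ∈ (Finset.univ : Finset (Layer r)), (goodSet M K B s')ᶜ)
      ≤ Fintype.card (Layer r) * (2 / K) := by
    refine (measureReal_biUnion_finset_le _ _).trans ?_
    refine (Finset.sum_le_sum fun s' _ => hgood s' B).trans (le_of_eq ?_)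
    simp
  have h2 : (layeredBeta B).real {H | K * thru n s.1 ≤ score (layerObs H s) (B s) v ^ 2}
      ≤ 1 / K := by
    refine (measureReal_le_integral_div B (fun H => sq_nonneg _) (by positivity)).trans ?_
    rw [integral_score_sq, div_le_div_iff₀ (by positivity) hK]
    have : a ≤ thru n s.1 := vertexSum_le (by omega) (edgeVar_le_one (B s)) v
    nlinarith
  have h3 := measureReal_correction_ge_le hn hB (by positivity : 0 < ε / 2) s v hz'
  have h4 := (measureReal_union_le (μ := layeredBeta B)
    {H | K * thru n s.1 ≤ score (layerObs H s) (B s) v ^ 2}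
    {H | ε / 2 ≤ |√a * ∑ u, z u * score (layerObs H s) (B s) u|})
  have h5 : (2 * Fintype.card (Layer r) + 1) / K
      = Fintype.card (Layer r) * (2 / K) + 1 / K := by ring
  linarith

end MaximumLikelihood

/-! ### Joint asymptotic normality of degrees and of estimation errors. -/

section CentralLimit

variable {n r : ℕ} {a : Layer r → ℕ}

/-- The coefficients of the linear combination with weights `τ` of the degrees of the selected
vertices. -/
noncomputable def degreeCoeff (v : (s : Layer r) → Fin (a s) ↪ Fin n)
    (τ : (Σ s : Layer r, Fin (a s)) → ℝ) : Params n r :=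
  fun s => ∑ i, Pi.single (v s i) (τ ⟨s, i⟩)

theorem sum_sum_single_mul {k : ℕ} (v : Fin k → Fin n) (τ : Fin k → ℝ) (f : Fin n → ℝ) :
    ∑ u, (∑ i, Pi.single (v i) (τ i) : Fin n → ℝ) u * f u = ∑ i, τ i * f (v i) := by
  simp_rw [Finset.sum_apply, Finset.sum_mul]
  rw [Finset.sum_comm]
  refine Finset.sum_congr rfl fun i _ => ?_
  rw [Finset.sum_eq_single (v i)]
  · rw [Pi.single_eq_same]
  · intro u _ hu
    rw [Pi.single_eq_of_ne hu, zero_mul]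
  · simp

theorem degreeCoeff_apply (v : (s : Layer r) → Fin (a s) ↪ Fin n)
    (τ : (Σ s : Layer r, Fin (a s)) → ℝ) (s : Layer r) (i : Fin (a s)) :
    degreeCoeff v τ s (v s i) = τ ⟨s, i⟩ := by
  rw [degreeCoeff, Finset.sum_apply, Finset.sum_eq_single i]
  · rw [Pi.single_eq_same]
  · intro j _ hj
    rw [Pi.single_eq_of_ne fun h => hj ((v s).injective h).symm]
  · simp

theorem linStat_degreeCoeff (B : Params n r) (v : (s : Layer r) → Fin (a s) ↪ Fin n)
    (τ : (Σ s : Layer r, Fin (a s)) → ℝ) (H : LayeredHypergraph n r) :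
    linStat B (degreeCoeff v τ) H
      = ∑ i, τ i * score (layerObs H i.1) (B i.1) (v i.1 i.2) := by
  rw [linStat_eq, Fintype.sum_sigma]
  exact Finset.sum_congr rfl fun s _ =>
    sum_sum_single_mul (v s) (fun i => τ ⟨s, i⟩) _

theorem sum_abs_degreeCoeff_le_layer (v : (s : Layer r) → Fin (a s) ↪ Fin n)
    (τ : (Σ s : Layer r, Fin (a s)) → ℝ) (s : Layer r) :
    ∑ u, |degreeCoeff v τ s u| ≤ ∑ i, |τ ⟨s, i⟩| := by
  refine (Finset.sum_le_sum fun u _ => (by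
    rw [degreeCoeff, Finset.sum_apply]
    exact Finset.abs_sum_le_sum_abs _ _ :
      |degreeCoeff v τ s u| ≤ ∑ i, |(Pi.single (v s i) (τ ⟨s, i⟩) : Fin n → ℝ) u|)).trans ?_
  rw [Finset.sum_comm]
  refine Finset.sum_le_sum fun i _ => le_of_eq ?_
  rw [Finset.sum_eq_single (v s i)]
  · rw [Pi.single_eq_same]
  · intro u _ hu
    rw [Pi.single_eq_of_ne hu, abs_zero]
  · simp

theorem sum_abs_degreeCoeff_le (v : (s : Layer r) → Fin (a s) ↪ Fin n)
    (τ : (Σ s : Layer r, Fin (a s)) → ℝ) (s : Layer r) :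
    ∑ u, |degreeCoeff v τ s u| ≤ ∑ i, |τ i| := by
  refine (sum_abs_degreeCoeff_le_layer v τ s).trans ?_
  rw [Fintype.sum_sigma]
  exact Finset.single_le_sum (f := fun s => ∑ i, |τ ⟨s, i⟩|)
    (fun _ _ => Finset.sum_nonneg fun _ _ => abs_nonneg _) (Finset.mem_univ s)

theorem abs_edgeSum_le_sum {s : ℕ} (x : Fin n → ℝ) (e : SEdge n s) :
    |edgeSum x e| ≤ ∑ u, |x u| :=
  (Finset.abs_sum_le_sum_abs _ _).trans
    (Finset.sum_le_sum_of_subset_of_nonneg (Finset.subset_univ _) fun _ _ _ => abs_nonneg _)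

theorem curvature_anti {A A' : ℝ} (h : A ≤ A') : curvature A' ≤ curvature A := by
  unfold curvature
  have := Real.exp_le_exp.2 h
  gcongr

theorem div_le_thru_layer (s : Layer r) (hn : 2 * r ≤ n) : (n : ℝ) / r ≤ thru n s.1 := by
  have hs := two_le_layer s
  have hsr := layer_le s
  refine le_trans ?_ (div_le_thru hs (by omega))
  have h1 : (0 : ℝ) < s.1 := by exact_mod_cast (by omega : 0 < s.1)
  have h2 : (s.1 : ℝ) ≤ r := by exact_mod_cast hsr
  gcongr

/-- The normalized degrees of distinct vertices are asymptotically uncorrelated. -/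
theorem abs_statVar_sub_le {M : ℝ} (hn : 2 * r ≤ n) {B : Params n r} (hB : ∀ s v, |B s v| ≤ M)
    {c : ℝ} (hc : 0 < c) (hcB : ∀ s : Layer r, c ≤ curvature (s.1 * (M + 1)))
    (v : (s : Layer r) → Fin (a s) ↪ Fin n) (t τ : (Σ s : Layer r, Fin (a s)) → ℝ)
    (hτ : ∀ i, τ i = t i / sigma B i.1 (v i.1 i.2)) :
    |statVar B (degreeCoeff v τ) - ∑ i, t i ^ 2| ≤ (∑ i, |t i|) ^ 2 * (r / (c * n)) ∧
      ∀ e : HyperEdge n r, |edgeSum (degreeCoeff v τ e.1) e.2|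
        ≤ (∑ i, |t i|) * √(r / (c * n)) := by
  have hw : ∀ (s : Layer r) (e : SEdge n s.1), c ≤ edgeVar (B s) e :=
    fun s e => (hcB s).trans (curvature_le_edgeVar (hB s) e)
  have hns : ∀ s : Layer r, 2 * s.1 ≤ n := fun s =>
    (Nat.mul_le_mul_left 2 (layer_le s)).trans hn
  have hq : ∀ s : Layer r, 0 < thru n s.1 := fun s => thru_pos (two_le_layer s) (hns s)
  have hvar : ∀ (s : Layer r) (u : Fin n),
      c * thru n s.1 ≤ vertexSum (s := s.1) (edgeVar (B s)) u := fun s u =>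
    le_vertexSum (by have := two_le_layer s; omega) (hw s) u
  have hvar0 : ∀ (s : Layer r) (u : Fin n), 0 < vertexSum (s := s.1) (edgeVar (B s)) u :=
    fun s u => (mul_pos hc (hq s)).trans_le (hvar s u)
  have hτabs : ∀ i, |τ i| * √(c * thru n i.1.1) ≤ |t i| := by
    intro i
    rw [hτ, sigma_eq, abs_div, abs_of_nonneg (Real.sqrt_nonneg _), div_mul_eq_mul_div,
      div_le_iff₀ (Real.sqrt_pos.2 (hvar0 _ _))]
    exact mul_le_mul_of_nonneg_left (Real.sqrt_le_sqrt (hvar _ _)) (abs_nonneg _)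
  have hτle : ∀ i, |τ i| ≤ |t i| * √(r / (c * n)) := by
    intro i
    have hn0 : (0 : ℝ) < n := by
      have := hns i.1
      have := two_le_layer i.1
      exact_mod_cast (by omega : 0 < n)
    have hr0 : (0 : ℝ) < r := by
      have := two_le_layer i.1
      have := layer_le i.1
      exact_mod_cast (by omega : 0 < r)
    have h1 : √(c * (n / r)) ≤ √(c * thru n i.1.1) :=
      Real.sqrt_le_sqrt (mul_le_mul_of_nonneg_left (div_le_thru_layer i.1 hn) hc.le)
    have h2 : √(c * (n / r)) * √(r / (c * n)) = 1 := by
      rw [← Real.sqrt_mul (by positivity)]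
      rw [show c * (n / r) * (r / (c * n)) = (1 : ℝ) by field_simp, Real.sqrt_one]
    calc |τ i| = |τ i| * √(c * (n / r)) * √(r / (c * n)) := by rw [mul_assoc, h2, mul_one]
      _ ≤ |t i| * √(r / (c * n)) :=
          mul_le_mul_of_nonneg_right
            ((mul_le_mul_of_nonneg_left h1 (abs_nonneg _)).trans (hτabs i)) (Real.sqrt_nonneg _)
  have hsumτ : ∑ i, |τ i| ≤ (∑ i, |t i|) * √(r / (c * n)) := by
    rw [Finset.sum_mul]
    exact Finset.sum_le_sum fun i _ => hτle i
  refine ⟨?_, fun e => (abs_edgeSum_le_sum _ _).trans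
    ((sum_abs_degreeCoeff_le v τ e.1).trans hsumτ)⟩
  have hstat : statVar B (degreeCoeff v τ)
      = ∑ i : Σ s : Layer r, Fin (a s),
        τ i * gram (s := i.1.1) (edgeVar (B i.1)) (degreeCoeff v τ i.1) (v i.1 i.2) := by
    rw [statVar, Fintype.sum_sigma]
    exact Finset.sum_congr rfl fun s _ => sum_sum_single_mul (v s) (fun i => τ ⟨s, i⟩) _
  -- The normalization by σ makes the diagonal part of the variance exactly ∑ t_i², so only
  -- off-diagonal Gram entries within one layer contribute to the error.
  have hdiag : ∀ i : Σ s : Layer r, Fin (a s),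
      t i ^ 2 = τ i * (vertexSum (s := i.1.1) (edgeVar (B i.1)) (v i.1 i.2)
        * degreeCoeff v τ i.1 (v i.1 i.2)) := by
    rintro ⟨s, i⟩
    have h1 := hvar0 s (v s i)
    rw [degreeCoeff_apply, hτ, sigma_eq]
    have h2 := Real.sqrt_pos.2 h1
    have h3 : vertexSum (s := s.1) (edgeVar (B s)) (v s i)
        = √(vertexSum (s := s.1) (edgeVar (B s)) (v s i)) ^ 2 := (Real.sq_sqrt h1.le).symm
    dsimp only
    nth_rewrite 2 [h3]
    field_simp
  rw [hstat, Finset.sum_congr rfl fun i _ => hdiag i, ← Finset.sum_sub_distrib]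
  refine (Finset.abs_sum_le_sum_abs _ _).trans ?_
  have hterm : ∀ i : Σ s : Layer r, Fin (a s),
      |τ i * gram (s := i.1.1) (edgeVar (B i.1)) (degreeCoeff v τ i.1) (v i.1 i.2)
        - τ i * (vertexSum (s := i.1.1) (edgeVar (B i.1)) (v i.1 i.2)
          * degreeCoeff v τ i.1 (v i.1 i.2))| ≤ |t i| * (∑ i, |t i|) * (r / (c * n)) := by
    rintro ⟨s, i⟩
    have hs := two_le_layer s
    rw [← mul_sub, abs_mul]
    have h1 := abs_gram_sub_le hs (edgeVar_nonneg (B s)) (edgeVar_le_one (B s))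
      (degreeCoeff v τ s) (v s i)
    have h2 : ∑ u, |degreeCoeff v τ s u| * √(c * thru n s.1) ≤ ∑ i, |t i| := by
      rw [← Finset.sum_mul]
      refine (mul_le_mul_of_nonneg_right
        (sum_abs_degreeCoeff_le_layer v τ s) (Real.sqrt_nonneg _)).trans ?_
      rw [Finset.sum_mul, Fintype.sum_sigma]
      refine (Finset.sum_le_sum fun i _ => hτabs ⟨s, i⟩).trans ?_
      exact Finset.single_le_sum (f := fun s => ∑ i, |t ⟨s, i⟩|)
        (fun _ _ => Finset.sum_nonneg fun _ _ => abs_nonneg _) (Finset.mem_univ s)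
    rw [← Finset.sum_mul] at h2
    have hcq : 0 < c * thru n s.1 := mul_pos hc (hq s)
    have hsq : √(c * thru n s.1) * √(c * thru n s.1) = c * thru n s.1 :=
      Real.mul_self_sqrt hcq.le
    have hn0 : (0 : ℝ) < n := by
      have := hns s
      exact_mod_cast (by omega : 0 < n)
    have hm : thruPair n s.1 / (c * thru n s.1) ≤ r / (c * n) := by
      rw [div_le_div_iff₀ hcq (by positivity)]
      have h3 := thruPair_mul_le hs (hns s)
      have h4 : (s.1 : ℝ) ≤ r := by exact_mod_cast layer_le s
      have h5 : (s.1 : ℝ) * thru n s.1 ≤ r * thru n s.1 :=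
        mul_le_mul_of_nonneg_right h4 (hq s).le
      nlinarith
    calc _ ≤ |τ ⟨s, i⟩| * (thruPair n s.1 * ∑ u, |degreeCoeff v τ s u|) :=
          mul_le_mul_of_nonneg_left h1 (abs_nonneg _)
      _ = (|τ ⟨s, i⟩| * √(c * thru n s.1))
            * ((∑ u, |degreeCoeff v τ s u|) * √(c * thru n s.1))
            * (thruPair n s.1 / (c * thru n s.1)) := by
          have := hq s
          rw [mul_mul_mul_comm, hsq]
          field_simp
      _ ≤ |t ⟨s, i⟩| * (∑ i, |t i|) * (r / (c * n)) := by
          have := hτabs ⟨s, i⟩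
          have h0 : 0 ≤ ∑ i, |t i| := Finset.sum_nonneg fun i _ => abs_nonneg _
          have hp : 0 ≤ ∑ u, |degreeCoeff v τ s u| := Finset.sum_nonneg fun i _ => abs_nonneg _
          have hm0 := div_nonneg (thruPair_nonneg (n := n) (s := s.1)) hcq.le
          gcongr
  refine (Finset.sum_le_sum fun i _ => hterm i).trans (le_of_eq ?_)
  rw [← Finset.sum_mul, ← Finset.sum_mul, sq]

theorem abs_exp_neg_sub_le {x y : ℝ} (hx : 0 ≤ x) (hy : 0 ≤ y) :
    |Real.exp (-x / 2) - Real.exp (-y / 2)| ≤ |x - y| := by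
  wlog h : x ≤ y generalizing x y
  · rw [abs_sub_comm, abs_sub_comm x]
    exact this hy hx (not_le.1 h).le
  have h1 : Real.exp (-y / 2) ≤ Real.exp (-x / 2) := Real.exp_le_exp.2 (by linarith)
  rw [abs_of_nonneg (sub_nonneg.2 h1), abs_of_nonpos (sub_nonpos.2 h)]
  have h2 : Real.exp (-y / 2) = Real.exp (-x / 2) * Real.exp (-(y - x) / 2) := by
    rw [← Real.exp_add]
    ring_nf
  have h3 : Real.exp (-x / 2) ≤ 1 := Real.exp_le_one_iff.2 (by linarith)
  have h4 := Real.add_one_le_exp (-(y - x) / 2)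
  have h5 : Real.exp (-(y - x) / 2) ≤ 1 := Real.exp_le_one_iff.2 (by linarith)
  rw [h2]
  nlinarith [Real.exp_pos (-x / 2)]

theorem statVar_nonneg (B y : Params n r) : 0 ≤ statVar B y := by
  rw [statVar_eq]
  refine Finset.sum_nonneg fun e _ => mul_nonneg (sq_nonneg _) ?_
  obtain ⟨h0, h1⟩ := edgeProb_mem B e
  exact mul_nonneg h0 (sub_nonneg.2 h1)

/-- Central limit theorem for the normalized centred degrees of finitely many vertices. -/
theorem eventually_norm_charFun_degrees_sub_le (M : ℝ) (t : (Σ s : Layer r, Fin (a s)) → ℝ)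
    {ε : ℝ} (hε : 0 < ε) :
    ∀ᶠ n : ℕ in atTop, ∀ B : Params n r, (∀ s v, |B s v| ≤ M) →
      ∀ v : (s : Layer r) → Fin (a s) ↪ Fin n,
        ‖∫ H, Complex.exp ((∑ i, t i * (score (layerObs H i.1) (B i.1) (v i.1 i.2)
            / sigma B i.1 (v i.1 i.2)) : ℝ) * Complex.I) ∂layeredBeta B
          - (Real.exp (-(∑ i, t i ^ 2) / 2) : ℝ)‖ ≤ ε := by
  -- One curvature constant for all layers: the sum of absolute values dominates each argument.
  obtain ⟨c, hc, hcM⟩ : ∃ c, 0 < c ∧ ∀ s : Layer r, c ≤ curvature (s.1 * (M + 1)) := by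
    refine ⟨curvature (∑ s : Layer r, |s.1 * (M + 1)|), curvature_pos _, fun s => ?_⟩
    exact curvature_anti ((le_abs_self _).trans
      (Finset.single_le_sum (f := fun s : Layer r => |s.1 * (M + 1)|)
        (fun s _ => abs_nonneg _) (Finset.mem_univ s)))
  set T := ∑ i, |t i| with hT
  set Q := ∑ i, t i ^ 2 with hQ
  have hrn : Tendsto (fun n : ℕ => (r : ℝ) / (c * n)) atTop (nhds 0) := by
    simp_rw [← div_div]
    exact tendsto_const_div_atTop_nhds_zero_nat _
  have hδ : Tendsto (fun n : ℕ => T ^ 2 * ((r : ℝ) / (c * n))) atTop (nhds 0) := by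
    simpa using hrn.const_mul (T ^ 2)
  have hη : Tendsto (fun n : ℕ => T * √((r : ℝ) / (c * n))) atTop (nhds 0) := by
    simpa using hrn.sqrt.const_mul T
  have hbound : Tendsto (fun n : ℕ => 4 * (T * √((r : ℝ) / (c * n))) / c
      * (Q + T ^ 2 * ((r : ℝ) / (c * n))) + T ^ 2 * ((r : ℝ) / (c * n))) atTop (nhds 0) := by
    have := (((hη.const_mul 4).div_const c).mul (hδ.const_add Q)).add hδ
    simpa using this
  filter_upwards [eventually_ge_atTop (2 * r), hη.eventually_le_const zero_lt_one,
    hbound.eventually_le_const hε] with n hn hη1 hfin B hB v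
  obtain ⟨hV, hedge⟩ := abs_statVar_sub_le hn hB hc hcM v t
    (fun i => t i / sigma B i.1 (v i.1 i.2)) fun i => rfl
  set y := degreeCoeff v (fun i => t i / sigma B i.1 (v i.1 i.2)) with hy
  have hclt := norm_charFun_linStat_sub_le B y hη1 hedge hc
    (fun e => (hcM e.1).trans (curvature_le_edgeVar (hB e.1) e.2))
  have hlin : ∀ H, linStat B y H = ∑ i, t i * (score (layerObs H i.1) (B i.1) (v i.1 i.2)
      / sigma B i.1 (v i.1 i.2)) := by
    intro H
    rw [hy, linStat_degreeCoeff]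
    exact Finset.sum_congr rfl fun i _ => by ring
  simp_rw [hlin] at hclt
  have hQ0 : 0 ≤ Q := Finset.sum_nonneg fun i _ => sq_nonneg _
  have hT0 : 0 ≤ T := Finset.sum_nonneg fun i _ => abs_nonneg _
  have hexp := (abs_exp_neg_sub_le (statVar_nonneg B y) hQ0).trans hV
  have hVle : statVar B y ≤ Q + T ^ 2 * (r / (c * n)) := by linarith [(abs_le.1 hV).2]
  refine le_trans ?_ hfin
  refine (norm_sub_le_norm_sub_add_norm_sub _ ((Real.exp (-statVar B y / 2) : ℝ) : ℂ) _).trans ?_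
  refine add_le_add (hclt.trans ?_) ?_
  · gcongr
  · rw [← Complex.ofReal_sub, Complex.norm_real]
    exact hexp

theorem norm_exp_I_sub_le (x y : ℝ) :
    ‖Complex.exp (x * Complex.I) - Complex.exp (y * Complex.I)‖ ≤ |x - y| := by
  have h : Complex.exp (x * Complex.I) - Complex.exp (y * Complex.I)
      = Complex.exp (y * Complex.I) * (Complex.exp (Complex.I * (x - y : ℝ)) - 1) := by
    rw [mul_sub, ← Complex.exp_add, mul_one]
    push_cast
    ring_nf
  rw [h, norm_mul, Complex.norm_exp_ofReal_mul_I, one_mul]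
  exact Real.norm_exp_I_mul_ofReal_sub_one_le

/-- Characteristic functions of nearby statistics are close. -/
theorem norm_integral_exp_sub_le (B : Params n r) (f g : LayeredHypergraph n r → ℝ) {ε : ℝ}
    (hε : 0 ≤ ε) :
    ‖∫ H, Complex.exp (f H * Complex.I) ∂layeredBeta B
      - ∫ H, Complex.exp (g H * Complex.I) ∂layeredBeta B‖
      ≤ ε + 2 * (layeredBeta B).real {H | ε ≤ |f H - g H|} := by
  rw [← integral_sub (integrable_layeredBeta B _) (integrable_layeredBeta B _)]
  refine (norm_integral_le_integral_norm _).trans ?_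
  have hpt : ∀ H, ‖Complex.exp (f H * Complex.I) - Complex.exp (g H * Complex.I)‖
      ≤ ε + 2 * Set.indicator {H | ε ≤ |f H - g H|} (fun _ => (1 : ℝ)) H := by
    intro H
    by_cases h : ε ≤ |f H - g H|
    · rw [Set.indicator_of_mem (by exact h)]
      refine (norm_sub_le _ _).trans ?_
      rw [Complex.norm_exp_ofReal_mul_I, Complex.norm_exp_ofReal_mul_I]
      linarith
    · rw [Set.indicator_of_notMem (by exact h)]
      refine (norm_exp_I_sub_le _ _).trans ?_
      linarith [not_le.1 h]
  refine (integral_mono (integrable_layeredBeta B _) (integrable_layeredBeta B _) hpt).trans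
    (le_of_eq ?_)
  rw [integral_add (integrable_layeredBeta B _) (integrable_layeredBeta B _),
    integral_const_mul, integral_indicator_const _ (Set.toFinite _).measurableSet]
  simp

/-- The characteristic function of the normalized estimation errors converges. -/
theorem eventually_norm_charFun_estimate_sub_le (M : ℝ) (t : (Σ s : Layer r, Fin (a s)) → ℝ)
    {ε : ℝ} (hε : 0 < ε) :
    ∀ᶠ n : ℕ in atTop, ∀ B : Params n r, (∀ s v, |B s v| ≤ M) →
      ∀ Bhat : LayeredHypergraph n r → Params n r, IsMLE Bhat →
      ∀ v : (s : Layer r) → Fin (a s) ↪ Fin n,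
        ‖∫ H, Complex.exp ((∑ i, t i * (sigma B i.1 (v i.1 i.2)
            * (Bhat H i.1 (v i.1 i.2) - B i.1 (v i.1 i.2))) : ℝ) * Complex.I) ∂layeredBeta B
          - (Real.exp (-(∑ i, t i ^ 2) / 2) : ℝ)‖ ≤ ε := by
  set T := ∑ i, |t i| with hT
  have hT0 : 0 ≤ T := Finset.sum_nonneg fun i _ => abs_nonneg _
  set L : ℝ := ((Fintype.card (Σ s : Layer r, Fin (a s)) : ℕ) : ℝ) with hL
  have hL0 : 0 ≤ L := Nat.cast_nonneg _
  -- Replacing errors by degrees costs ε/4 off the exceptional event and twice its probability, at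
  -- most ε/8, on it; the degree limit theorem uses the remaining ε/2. The `+ 1` covers T = 0 and an
  -- empty index set.
  have hδ : 0 < ε / (4 * (T + 1)) := by positivity
  have hη : 0 < ε / (8 * (L + 1)) := by positivity
  filter_upwards [eventually_norm_charFun_degrees_sub_le (a := a) M t (half_pos hε),
    eventually_all.2 fun s : Layer r => eventually_measureReal_linearization_le M s hδ hη]
    with n hclt hlin B hB Bhat hMLE v
  have h1 := norm_integral_exp_sub_le B
    (fun H => ∑ i, t i * (sigma B i.1 (v i.1 i.2)
            * (Bhat H i.1 (v i.1 i.2) - B i.1 (v i.1 i.2))))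
    (fun H => ∑ i, t i * (score (layerObs H i.1) (B i.1) (v i.1 i.2)
            / sigma B i.1 (v i.1 i.2))) (by positivity : 0 ≤ ε / 4)
  have hsub : {H | ε / 4 ≤ |∑ i, t i * (sigma B i.1 (v i.1 i.2)
            * (Bhat H i.1 (v i.1 i.2) - B i.1 (v i.1 i.2)))
          - ∑ i, t i * (score (layerObs H i.1) (B i.1) (v i.1 i.2)
            / sigma B i.1 (v i.1 i.2))|}
      ⊆ ⋃ i ∈ (Finset.univ : Finset (Σ s : Layer r, Fin (a s))),
        {H | ε / (4 * (T + 1)) ≤ |sigma B i.1 (v i.1 i.2)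
            * (Bhat H i.1 (v i.1 i.2) - B i.1 (v i.1 i.2))
          - score (layerObs H i.1) (B i.1) (v i.1 i.2) / sigma B i.1 (v i.1 i.2)|} := by
    intro H hH
    by_contra hcon
    simp only [Set.mem_iUnion, Finset.mem_univ, exists_true_left, not_exists,
      Set.mem_ofPred_eq, not_le] at hcon
    have h2 : |∑ i, t i * (sigma B i.1 (v i.1 i.2)
            * (Bhat H i.1 (v i.1 i.2) - B i.1 (v i.1 i.2)))
          - ∑ i, t i * (score (layerObs H i.1) (B i.1) (v i.1 i.2)
            / sigma B i.1 (v i.1 i.2))| ≤ T * (ε / (4 * (T + 1))) := by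
      rw [← Finset.sum_sub_distrib, hT, Finset.sum_mul]
      refine (Finset.abs_sum_le_sum_abs _ _).trans (Finset.sum_le_sum fun i _ => ?_)
      rw [← mul_sub, abs_mul]
      exact mul_le_mul_of_nonneg_left (hcon i).le (abs_nonneg _)
    have h3 : T * (ε / (4 * (T + 1))) < ε / 4 := by
      rw [mul_div_assoc', div_lt_div_iff₀ (by positivity) (by norm_num)]
      nlinarith
    rw [Set.mem_ofPred_eq] at hH
    linarith
  have h4 := (measureReal_mono (μ := layeredBeta B) hsub (measure_ne_top _ _)).trans
    ((measureReal_biUnion_finset_le _ _).trans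
      (Finset.sum_le_sum fun i _ => hlin i.1 B hB Bhat hMLE (v i.1 i.2)))
  have h5 : ∑ _i : Σ s : Layer r, Fin (a s), ε / (8 * (L + 1)) ≤ ε / 8 := by
    rw [Finset.sum_const, nsmul_eq_mul, Finset.card_univ, ← hL, mul_div_assoc',
      div_le_div_iff₀ (by positivity) (by norm_num)]
    nlinarith
  refine (norm_sub_le_norm_sub_add_norm_sub _ _ _).trans
    ((add_le_add h1 (hclt B hB v)).trans ?_)
  linarith

end CentralLimit

end HypergraphBeta

/-! ### Convergence in distribution by Lévy's continuity theorem. -/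

theorem theorem2p3 (r : ℕ) (hr : 2 ≤ r) (M : ℝ)
    (N : ℕ → ℕ) (hN : Tendsto N atTop atTop)
    (B : (k : ℕ) → HypergraphBeta.Params (N k) r)
    (hB : ∀ (k : ℕ) (s : HypergraphBeta.Layer r) (v : Fin (N k)), |B k s v| ≤ M)
    (Bhat : (k : ℕ) → HypergraphBeta.LayeredHypergraph (N k) r → HypergraphBeta.Params (N k) r)
    (hBhat : ∀ k : ℕ, HypergraphBeta.IsMLE (Bhat k))
    (a : HypergraphBeta.Layer r → ℕ)
    (v : (k : ℕ) → (s : HypergraphBeta.Layer r) → Fin (a s) ↪ Fin (N k))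
    {Ω : ℕ → Type*} [∀ k : ℕ, MeasurableSpace (Ω k)]
    (P : (k : ℕ) → Measure (Ω k)) [∀ k : ℕ, IsProbabilityMeasure (P k)]
    (H : (k : ℕ) → Ω k → HypergraphBeta.LayeredHypergraph (N k) r)
    (hH : ∀ k : ℕ, HasLaw (H k) (HypergraphBeta.layeredBeta (B k)) (P k)) :
    TendstoInDistribution
      (fun (k : ℕ) (ω : Ω k) (i : Σ s : HypergraphBeta.Layer r, Fin (a s)) =>
        HypergraphBeta.sigma (B k) i.1 (v k i.1 i.2) *
          (Bhat k (H k ω) i.1 (v k i.1 i.2) - B k i.1 (v k i.1 i.2)))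
      atTop
      (fun z : (Σ s : HypergraphBeta.Layer r, Fin (a s)) → ℝ => z)
      P
      (Measure.pi fun _ : Σ s : HypergraphBeta.Layer r, Fin (a s) => gaussianReal 0 1) := by
  -- Characteristic functions are taken on an inner product space, so the vector is placed in
  -- `EuclideanSpace`; the continuous map back to plain functions is applied at the end.
  let F : (k : ℕ) → HypergraphBeta.LayeredHypergraph (N k) r →
      EuclideanSpace ℝ (Σ s : HypergraphBeta.Layer r, Fin (a s)) := fun k h =>
    WithLp.toLp 2 fun i => HypergraphBeta.sigma (B k) i.1 (v k i.1 i.2) *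
      (Bhat k h i.1 (v k i.1 i.2) - B k i.1 (v k i.1 i.2))
  have hF : ∀ k, Measurable (F k) := fun k => measurable_of_finite _
  have hconv : TendstoInDistribution (fun k ω => F k (H k ω)) atTop
      (fun z : (Σ s : HypergraphBeta.Layer r, Fin (a s)) → ℝ => WithLp.toLp 2 z) P
      (Measure.pi fun _ : Σ s : HypergraphBeta.Layer r, Fin (a s) => gaussianReal 0 1) := by
    refine ⟨fun k => (hF k).comp_aemeasurable (hH k).aemeasurable, by fun_prop, ?_⟩
    refine ProbabilityMeasure.tendsto_iff_tendsto_charFun.2 fun t => ?_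
    have hlim : charFun ((Measure.pi fun _ : Σ s : HypergraphBeta.Layer r, Fin (a s) =>
        gaussianReal 0 1).map (fun z => WithLp.toLp 2 z)) t
        = (Real.exp (-(∑ i, t i ^ 2) / 2) : ℝ) := by
      rw [charFun_pi]
      simp_rw [charFun_gaussianReal]
      rw [← Complex.exp_sum]
      push_cast
      congr 1
      simp [Finset.sum_div, neg_div, Finset.sum_neg_distrib]
    have hk : ∀ k, charFun ((P k).map fun ω => F k (H k ω)) t
        = ∫ h, Complex.exp ((∑ i, t i * (HypergraphBeta.sigma (B k) i.1 (v k i.1 i.2)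
            * (Bhat k h i.1 (v k i.1 i.2) - B k i.1 (v k i.1 i.2))) : ℝ) * Complex.I)
            ∂HypergraphBeta.layeredBeta (B k) := by
      intro k
      have hmap : (P k).map (fun ω => F k (H k ω))
          = (HypergraphBeta.layeredBeta (B k)).map (F k) := by
        rw [← (hH k).map_eq, AEMeasurable.map_map_of_aemeasurable (hF k).aemeasurable
          (hH k).aemeasurable]
        rfl
      rw [hmap, charFun_apply, integral_map (hF k).aemeasurable (by fun_prop)]
      rfl
    simp only [ProbabilityMeasure.coe_mk, hlim, hk]
    rw [Metric.tendsto_atTop']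
    intro ε hε
    -- The estimate is uniform over bounded parameters, estimators and vertex choices at each size,
    -- so it can be pulled back along `N`.
    obtain ⟨k₀, hk₀⟩ := (hN.eventually
      (HypergraphBeta.eventually_norm_charFun_estimate_sub_le (a := a) M t
        (half_pos hε))).exists_forall_of_atTop
    refine ⟨k₀, fun k hk => ?_⟩
    rw [dist_eq_norm]
    exact (hk₀ k hk.le (B k) (hB k) (Bhat k) (hBhat k) (v k)).trans_lt (half_lt_self hε)
  exact hconv.continuous_comp (PiLp.continuous_ofLp 2 _)
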